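/- Let $n\ge 1$ and $a,b>0$. Consider the dual graph of the Aztec diamond of order $n$: its vertices are the points $(X,Y)\in\mathbb{Z}^2$ with $|X-(n-\tfrac12)|+|Y-(n-\tfrac12)|\le n$, and its edges join vertices at distance $1$. A face is a unit square all of whose corners are vertices; it is named by its corner $(X,Y)$ with least coordinates. A face with $X+Y\equiv n-1 \pmod 2$ gets the weight $a$ if $X$ is even and $b$ if $X$ is odd (so that the face at $(0,n-1)$ has weight $a$); the other faces get weight $1$. The two-periodic measure on configurations $c$ (perfect matchings of this graph) is $\mathbb{P}(c)=w(c)/Z_n$, where $w(c)=\prod_{f}(\text{weight of } f)^{N_f(c)}$, $N_f(c)$ is the number of dimers of $c$ lying along the face $f$, and $Z_n=\sum_c w(c)$. For $1\le \ell\le n$ and $0\le k\le n$, there is a particle at height $k$ on level $\ell$ if the vertex $(\ell-1+k,\,n-\ell+k)$ is matched with its neighbour in direction $(1,0)$ or $(0,-1)$. On the additional level $n+1$ there is a particle at each height $0,1,\dots,n$. For $1\le m\le n+1$ and integers $x^{(\ell)}=(x^{(\ell)}_1,\dots,x^{(\ell)}_\ell)$, $1\le\ell\le m$, let $\rho(x^{(1)},\dots,x^{(m)})$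 be the probability that for each $\ell\le m$ the particles on level $\ell$ are at the heights $x^{(\ell)}_1<\dots<x^{(\ell)}_\ell$. (So $\rho=0$ if some $x^{(\ell)}$ is not strictly increasing.) Let $\chi(x^{(1)}\prec\dots\prec x^{(m)})$ be $1$ if all $x^{(\ell)}_i\in\{0,\dots,n\}$, $x^{(\ell)}_i<x^{(\ell)}_{i+1}$ and $x_i^{(\ell+1)}\le x_i^{(\ell)}\le x_{i+1}^{(\ell+1)}$, and $0$ otherwise. Let $$\Omega(x^{(1)},\dots,x^{(m-1)})=\frac{(a^2)^{\alpha^{\rm o}_{\inf}+\alpha^{\rm e}_{\sup}}\,(b^2)^{\alpha^{\rm e}_{\inf}+\alpha^{\rm o}_{\sup}}}{(a^2+b^2)^{\alpha}},$$ where $\alpha^{\rm e}_{\inf}$ (resp. $\alpha^{\rm o}_{\inf}$) is the number of pairs $(\ell,i)$ with $1\le i\le \ell\le m-1$, $x_i^{(\ell)}=x_i^{(\ell+1)}$ and $\ell+x_i^{(\ell)}$ even (resp. odd), $\alpha^{\rm e}_{\sup},\alpha^{\rm o}_{\sup}$ are defined in the same way with $x_i^{(\ell)}=x_{i+1}^{(\ell+1)}$,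 and $\alpha$ is the sum of these four numbers. Put $v=\frac12\,\frac{b^2-a^2}{a^2+b^2}$. Then $$\rho(x^{(1)},\dots,x^{(m)})=A_{n,m}\,\det_{1\le i,j\le m}\Big[L_{n-m+i,\,x^{(m)}_j}\big((-1)^m v\big)\Big]\cdot\Omega(x^{(1)},\dots,x^{(m-1)})\cdot\chi(x^{(1)}\prec\dots\prec x^{(m)}),$$ where, for $i\ge0$ and $j\in\mathbb{Z}$, the $L_{i,j}$ are defined by $L_{0,j}=\delta_{0,j}$ and $$L_{i+1,j}(v)=\big(L_{i,j}(v)+L_{i,j-1}(-v)\big)\beta_i(v),\qquad \beta_i(v)=\begin{cases}(1-2v)^{-1}& i\equiv0 \pmod 4,\\ (1+2v)^{-1}& i\equiv2 \pmod 4,\\ 1& i \text{ odd},\end{cases}$$ and $$A_{n,m}=\Big(\frac{1-4v^2}{4}\Big)^{m(n+1-m)/2}\begin{cases}\sqrt{\frac{1+2v}{1-2v}}& n\equiv1 \pmod 4,\ m \text{ odd},\\ \sqrt{\frac{1-2v}{1+2v}}& n\equiv3 \pmod 4,\ m \text{ odd},\\ 1&\text{otherwise.}\end{cases}$$ -/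

import Mathlib

noncomputable section

namespace TwoPeriodicAztec

/-! ## Dimer configurations of the Aztec diamond and the two-periodic measure -/

/-- The vertices of the dual graph of the Aztec diamond of order `n`: the points of `ℤ²` at
`ℓ¹`-distance at most `n` from the centre `(n - 1/2, n - 1/2)`. -/
def vertices (n : ℕ) : Finset (ℤ × ℤ) :=
  (Finset.Icc (0 : ℤ) (2 * n - 1) ×ˢ Finset.Icc (0 : ℤ) (2 * n - 1)).filter
    (fun p => |2 * p.1 - (2 * (n : ℤ) - 1)| + |2 * p.2 - (2 * (n : ℤ) - 1)| ≤ 2 * (n : ℤ))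

/-- The dual graph of the Aztec diamond of order `n`, as an induced subgraph of the square
lattice. -/
def graph (n : ℕ) : SimpleGraph (vertices n) where
  Adj p q := |p.1.1 - q.1.1| + |p.1.2 - q.1.2| = 1
  symm := ⟨fun p q h => by rw [abs_sub_comm q.1.1, abs_sub_comm q.1.2]; exact h⟩
  loopless := ⟨fun p h => by simp at h⟩

/-- Configurations of the Aztec diamond of order `n` (domino tilings, equivalently dimer coverings
of the dual graph). -/
abbrev Config (n : ℕ) : Type := {M : (graph n).Subgraph // M.IsPerfectMatching}

instance (n : ℕ) : Fintype (Config n) := Fintype.ofFinite _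

/-- The four corners of the unit square whose corner with least coordinates is `f`. -/
def corners (f : ℤ × ℤ) : Finset (ℤ × ℤ) :=
  {f, (f.1 + 1, f.2), (f.1, f.2 + 1), (f.1 + 1, f.2 + 1)}

/-- The (inner) faces of the dual graph; a face is named by its corner with least coordinates. -/
def faces (n : ℕ) : Finset (ℤ × ℤ) := (vertices n).filter (fun f => corners f ⊆ vertices n)

open Classical in
/-- The two-periodic face weights. One face in two carries a weight, in the checkerboard pattern
that contains the extreme face `(0, n - 1)`; the remaining faces carry none (weight `1`). Among the
weighted faces the weights `a` and `b` alternate, and the face `(0, n - 1)` has weight `a`. -/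
def faceWeight (a b : ℝ) (n : ℕ) (f : ℤ × ℤ) : ℝ :=
  if Even (f.1 + f.2 - ((n : ℤ) - 1)) then (if Even f.1 then a else b) else 1

/-- The number of dimers of the configuration `c` that are adjacent to the face `f`. -/
def dimersAround {n : ℕ} (c : Config n) (f : ℤ × ℤ) : ℕ :=
  Set.ncard {e : Sym2 (vertices n) | e ∈ c.1.edgeSet ∧ ∀ p ∈ e, (p : ℤ × ℤ) ∈ corners f}

/-- The weight of a configuration. -/
def weight (a b : ℝ) {n : ℕ} (c : Config n) : ℝ :=
  ∏ f ∈ faces n, faceWeight a b n f ^ dimersAround c f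

/-- The partition function. -/
def partitionFunction (a b : ℝ) (n : ℕ) : ℝ := ∑ c : Config n, weight a b c

/-- The probability of a configuration. -/
def prob (a b : ℝ) {n : ℕ} (c : Config n) : ℝ := weight a b c / partitionFunction a b n

/-! ## The particle system -/

/-- The site at height `k` on level `ℓ`. For `1 ≤ ℓ ≤ n` and `0 ≤ k ≤ n` these are the vertices of
one parity class of the bipartite graph. -/
def site (n ℓ : ℕ) (k : ℤ) : ℤ × ℤ := ((ℓ : ℤ) - 1 + k, (n : ℤ) - ℓ + k)

/-- The heights of the particles on level `ℓ`. For `1 ≤ ℓ ≤ n` there is a particle at a site when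
the dimer covering the site goes to the next column, that is, towards `(1, 0)` or `(0, -1)`
(the levels are ordered in the direction `(1, -1)`, heights in the direction `(1, 1)`).
The additional level `n + 1` is completely filled. -/
def particles {n : ℕ} (c : Config n) (ℓ : ℕ) : Set ℤ :=
  {k | (ℓ = n + 1 ∧ 0 ≤ k ∧ k ≤ n) ∨
    (1 ≤ ℓ ∧ ℓ ≤ n ∧ ∃ p q : vertices n, c.1.Adj p q ∧ (p : ℤ × ℤ) = site n ℓ k ∧
      ((q : ℤ × ℤ) = site n ℓ k + (1, 0) ∨ (q : ℤ × ℤ) = site n ℓ k + (0, -1)))}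

/-- A family of positions, with `ℓ` positions on each level `ℓ`. The value `x ℓ i` with `i : Fin ℓ`
is `x_{i+1}^{(ℓ)}` in the usual one-based numbering. -/
abbrev Positions : Type := (ℓ : ℕ) → Fin ℓ → ℤ

/-- `x^{(1)}, …, x^{(m)}` are the positions, listed increasingly on each level, of the particles
on the first `m` levels in the configuration `c`. -/
def Produces {n : ℕ} (c : Config n) (m : ℕ) (x : Positions) : Prop :=
  ∀ ℓ : ℕ, 1 ≤ ℓ → ℓ ≤ m → StrictMono (x ℓ) ∧ Set.range (x ℓ) = particles c ℓ

open Classical in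
/-- The probability density `ρ(x^{(1)}, …, x^{(m)})` of the particle system on the first `m`
levels, induced by the two-periodic measure on configurations. -/
def density (a b : ℝ) (n m : ℕ) (x : Positions) : ℝ :=
  ∑ c : Config n with Produces c m x, prob a b c

/-- The interlacing condition `x^{(1)} ≺ ⋯ ≺ x^{(m)}`. -/
def Interlaced (n m : ℕ) (x : Positions) : Prop :=
  (∀ ℓ : ℕ, 1 ≤ ℓ → ℓ ≤ m → (∀ i, 0 ≤ x ℓ i ∧ x ℓ i ≤ n) ∧ StrictMono (x ℓ)) ∧
  (∀ ℓ : ℕ, 1 ≤ ℓ → ℓ < m → ∀ i : Fin ℓ,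
    x (ℓ + 1) i.castSucc ≤ x ℓ i ∧ x ℓ i ≤ x (ℓ + 1) i.succ)

open Classical in
/-- The interlacing indicator `χ(x^{(1)} ≺ ⋯ ≺ x^{(m)})`. -/
def chi (n m : ℕ) (x : Positions) : ℝ := if Interlaced n m x then 1 else 0

/-! ## Adjacency functions and the adjacency weight -/

/-- The particle `x_i^{(ℓ)}` is adjacent to its inferior neighbour on level `ℓ + 1`. -/
def alphaInf (x : Positions) (ℓ : ℕ) (i : Fin ℓ) : ℕ :=
  if x ℓ i = x (ℓ + 1) i.castSucc then 1 else 0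

/-- The particle `x_i^{(ℓ)}` is adjacent to its superior neighbour on level `ℓ + 1`. -/
def alphaSup (x : Positions) (ℓ : ℕ) (i : Fin ℓ) : ℕ :=
  if x ℓ i = x (ℓ + 1) i.succ then 1 else 0

open Classical in
/-- Indicator of an even particle: `ℓ + x_i^{(ℓ)}` is even. -/
def evenInd (x : Positions) (ℓ : ℕ) (i : Fin ℓ) : ℕ := if Even ((ℓ : ℤ) + x ℓ i) then 1 else 0

open Classical in
/-- Indicator of an odd particle: `ℓ + x_i^{(ℓ)}` is odd. -/
def oddInd (x : Positions) (ℓ : ℕ) (i : Fin ℓ) : ℕ := if Odd ((ℓ : ℤ) + x ℓ i) then 1 else 0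

/-- The sum of the contributions of all particles on levels `1, …, k`. -/
def total (k : ℕ) (g : (ℓ : ℕ) → Fin ℓ → ℕ) : ℕ := ∑ ℓ ∈ Finset.Icc 1 k, ∑ i : Fin ℓ, g ℓ i

/-- The adjacency weight `Ω(x^{(1)}, …, x^{(k)})` (it also involves level `k + 1`, through the
adjacency functions). -/
def Omega (a b : ℝ) (k : ℕ) (x : Positions) : ℝ :=
  (a ^ 2) ^ (total k (fun ℓ i => alphaInf x ℓ i * oddInd x ℓ i)
      + total k (fun ℓ i => alphaSup x ℓ i * evenInd x ℓ i)) *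
  (b ^ 2) ^ (total k (fun ℓ i => alphaInf x ℓ i * evenInd x ℓ i)
      + total k (fun ℓ i => alphaSup x ℓ i * oddInd x ℓ i)) /
  (a ^ 2 + b ^ 2) ^ total k (fun ℓ i => alphaInf x ℓ i + alphaSup x ℓ i)

/-! ## The coefficients `L_{i,j}` and the constants `A_{n,m}` -/

/-- `v = (b² - a²) / (2 (a² + b²))`. -/
def vParam (a b : ℝ) : ℝ := 1 / 2 * ((b ^ 2 - a ^ 2) / (a ^ 2 + b ^ 2))

/-- The coefficients `β_i(v)`. -/
def beta (i : ℕ) (v : ℝ) : ℝ :=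
  if i % 4 = 0 then (1 - 2 * v)⁻¹ else if i % 4 = 2 then (1 + 2 * v)⁻¹ else 1

/-- The coefficients `L_{i,j}(v)`: `L_{0,j} = δ_{0,j}` and
`L_{i+1,j}(v) = (L_{i,j}(v) + L_{i,j-1}(-v)) β_i(v)`. -/
def L : ℕ → ℤ → ℝ → ℝ
  | 0, j, _ => if j = 0 then 1 else 0
  | i + 1, j, v => (L i j v + L i (j - 1) (-v)) * beta i v

/-- The constants `A_{n,m}`. -/
def A (v : ℝ) (n m : ℕ) : ℝ :=
  ((1 - 4 * v ^ 2) / 4) ^ (((m : ℝ) * ((n : ℝ) + 1 - (m : ℝ))) / 2) *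
    (if n % 4 = 1 ∧ m % 2 = 1 then √((1 + 2 * v) / (1 - 2 * v))
     else if n % 4 = 3 ∧ m % 2 = 1 then √((1 - 2 * v) / (1 + 2 * v))
     else 1)

end TwoPeriodicAztec

end

/-!
The proof removes the levels one at a time, starting from the configuration as a whole.

**Columns.** The vertices that are not sites form columns `ℓ = 0, …, n`, and a configuration amounts
to a choice of a direction for the dimer at each of these vertices (`sum_config_eq`). Every dimer
lies along exactly one face of the weighted parity class (`dimer_subset_corners_iff`); since the
number of dimers that go from column `ℓ` to level `ℓ` is always `ℓ`, the weight of a configuration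
is a constant times the product of `1/2 + (-1)^(ℓ+k) v` over the dimers at height `k` of column `ℓ`
that go to the left (`weight_eq_weightConst_mul`). If the particles on all levels are prescribed,
the columns decouple. In a column, the numbers of particles below a given height on the two adjacent
levels determine which dimers go upwards, and a covering exists exactly when the levels interlace.
The only freedom left is at a particle of level `ℓ` without an adjacent particle on level `ℓ + 1`,
where two coverings have weights `p` and `1 - p`, of sum `1` (`columnSum_eq_columnWeight`,
`columnSum_occupied`). Hence the density of all `n + 1` levels is proportional to `Ω χ`
(`density_all`).

**Summation of one level.** The density of `m` levels is the sum of the density of `m + 1` levels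
over the positions on level `m + 1` (`density_eq_sum`). The sum of `Ω χ` times the determinant of
`L` over these positions splits, by multilinearity, into sums over intervals with fractional end
terms, that is, into differences of the partial sums `cumL`. Column operations reduce it to a
determinant of partial sums. The relation `cumL_succ_sub`, which is a summed form of
`L_local_relation`, says that a combination of the partial sums of two consecutive rows is a
multiple of an entry of the array `L` with the sign of `v` reversed. Row operations then give the
determinant of `L` of size one less (`sum_levelWeight_mul_det`). The factors that are split off on
the way are those by which `A_{n,m}` and `A_{n,m+1}` differ (`A_succ`).

**Normalisation.** At the top level `n + 1` all heights are occupied and the determinant is a nonzero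
constant, because `L` is triangular. So the formula holds for all `m` up to a constant factor that
does not depend on `m` (`exists_density_eq`), and summing over the first level shows that this factor
is `1` (`sum_first_level`).
-/

noncomputable section

namespace TwoPeriodicAztec

/-! ### The recursion of the coefficients `L_{i,j}` -/

/-- The weight `1/2 + (-1)^t v`: up to normalisation, the weight of the dimer at height `k` which
covers a site of level `ℓ` from the right, with `t = ℓ + k`. -/
def edgeProb (v : ℝ) (t : ℤ) : ℝ := 1 / 2 + (if Even t then v else -v)

lemma edgeProb_add_one (v : ℝ) (t : ℤ) : edgeProb v (t + 1) = 1 - edgeProb v t := by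
  unfold edgeProb
  by_cases h : Even t
  · have : ¬ Even (t + 1) := by rw [Int.even_add_one]; simpa using h
    simp only [h, this, if_true, if_false]; ring
  · have : Even (t + 1) := by rw [Int.even_add_one]; simpa using h
    simp only [h, this, if_true, if_false]; ring

lemma edgeProb_sub_one (v : ℝ) (t : ℤ) : edgeProb v (t - 1) = 1 - edgeProb v t := by
  have := edgeProb_add_one v (t - 1)
  rw [sub_add_cancel] at this
  linarith

lemma edgeProb_neg (v : ℝ) (t : ℤ) : edgeProb (-v) t = 1 - edgeProb v t := by
  unfold edgeProb
  split_ifs <;> ring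

/-- The factor `(1 ± 2u)/2`, with the sign `+` for `r ≡ 0, 3` and `-` for `r ≡ 1, 2` modulo `4`,
that governs the passage from row `r` to row `r + 1` of the array `L`. -/
def rowFactor (r : ℕ) (u : ℝ) : ℝ :=
  if r % 4 = 0 ∨ r % 4 = 3 then (1 + 2 * u) / 2 else (1 - 2 * u) / 2

lemma rowFactor_ne_zero {u : ℝ} (h1 : 1 - 2 * u ≠ 0) (h2 : 1 + 2 * u ≠ 0) (r : ℕ) :
    rowFactor r u ≠ 0 := by
  unfold rowFactor
  split_ifs
  · exact div_ne_zero h2 two_ne_zero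
  · exact div_ne_zero h1 two_ne_zero

lemma rowFactor_mul_neg (r : ℕ) (u : ℝ) :
    rowFactor r u * rowFactor r (-u) = (1 - 4 * u ^ 2) / 4 := by
  unfold rowFactor
  split_ifs <;> ring

lemma mod_four_cases (r : ℕ) : (r % 4 = 0 ∧ (r + 1) % 4 = 1) ∨ (r % 4 = 1 ∧ (r + 1) % 4 = 2) ∨
    (r % 4 = 2 ∧ (r + 1) % 4 = 3) ∨ (r % 4 = 3 ∧ (r + 1) % 4 = 0) := by omega

lemma rowFactor_succ_mul_beta {u : ℝ} (h1 : 1 - 2 * u ≠ 0) (h2 : 1 + 2 * u ≠ 0) (r : ℕ) :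
    rowFactor (r + 1) u * beta (r + 1) (-u) = beta (r + 1) u * rowFactor r (-u) := by
  rcases mod_four_cases r with ⟨h, h'⟩ | ⟨h, h'⟩ | ⟨h, h'⟩ | ⟨h, h'⟩ <;>
  · simp [rowFactor, beta, h, h', ← sub_eq_add_neg]
    try field_simp

lemma rowFactor_beta_relation {u : ℝ} (h1 : 1 - 2 * u ≠ 0) (h2 : 1 + 2 * u ≠ 0) (r : ℕ) :
    (beta (r + 1) u - (rowFactor (r + 1) (-u))⁻¹) * (rowFactor r u * beta r u) =
      beta (r + 1) u * (rowFactor r (-u) * beta r u - 1) := by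
  rcases mod_four_cases r with ⟨h, h'⟩ | ⟨h, h'⟩ | ⟨h, h'⟩ | ⟨h, h'⟩ <;>
  · simp [rowFactor, beta, h, h', ← sub_eq_add_neg]
    field_simp
    ring

lemma L_zero (j : ℤ) (v : ℝ) : L 0 j v = if j = 0 then 1 else 0 := rfl

lemma L_succ (i : ℕ) (j : ℤ) (v : ℝ) :
    L (i + 1) j v = (L i j v + L i (j - 1) (-v)) * beta i v := rfl

lemma L_eq_zero_of_neg (i : ℕ) {j : ℤ} (hj : j < 0) (v : ℝ) : L i j v = 0 := by
  induction i generalizing j v with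
  | zero => rw [L_zero, if_neg hj.ne]
  | succ i ih => rw [L_succ, ih hj, ih (by omega)]; simp

lemma L_eq_zero_of_lt (i : ℕ) {j : ℤ} (hj : (i : ℤ) < j) (v : ℝ) : L i j v = 0 := by
  induction i generalizing j v with
  | zero => rw [L_zero, if_neg (by simpa using hj.ne')]
  | succ i ih =>
    push_cast at hj
    rw [L_succ, ih (by omega), ih (by omega)]; simp

lemma beta_ne_zero {u : ℝ} (h1 : 1 - 2 * u ≠ 0) (h2 : 1 + 2 * u ≠ 0) (i : ℕ) :
    beta i u ≠ 0 := by
  unfold beta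
  split_ifs
  · exact inv_ne_zero h1
  · exact inv_ne_zero h2
  · exact one_ne_zero

lemma L_diag_ne_zero {u : ℝ} (h1 : 1 - 2 * u ≠ 0) (h2 : 1 + 2 * u ≠ 0) (i : ℕ) :
    L i i u ≠ 0 := by
  induction i generalizing u with
  | zero => simp [L_zero]
  | succ i ih =>
    rw [L_succ, L_eq_zero_of_lt i (by simp), zero_add]
    refine mul_ne_zero ?_ (beta_ne_zero h1 h2 i)
    have := @ih (-u) (by ring_nf; ring_nf at h2; exact h2) (by ring_nf; ring_nf at h1; exact h1)
    simpa using this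

/-- The local linear relation between two consecutive rows of `L`, with arguments `u` and `-u`.
Relation `r + 1` at `(u, y)` is a combination of the relations `r` at `(u, y)` and at
`(-u, y - 1)`, because `edgeProb (-u) y = edgeProb u (y - 1)`. -/
lemma L_local_relation (r : ℕ) : ∀ {u : ℝ}, 1 - 2 * u ≠ 0 → 1 + 2 * u ≠ 0 → ∀ y : ℤ,
    edgeProb (-u) y * ((L (r + 1) y u - (rowFactor r (-u))⁻¹ * L r y u) +
      (L (r + 1) (y - 1) u - (rowFactor r (-u))⁻¹ * L r (y - 1) u)) =
    -rowFactor r u * (L (r + 1) y (-u) - L (r + 1) (y - 1) (-u)) := by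
  induction r with
  | zero =>
    intro u h1 h2 y
    have e1 : (rowFactor 0 (-u))⁻¹ = 2 * (1 - 2 * u)⁻¹ := by
      simp [rowFactor, ← sub_eq_add_neg]; field_simp
    have e2 : rowFactor 0 u = (1 + 2 * u) / 2 := by simp [rowFactor]
    have b1 : beta 0 u = (1 - 2 * u)⁻¹ := by simp [beta]
    have b2 : beta 0 (-u) = (1 + 2 * u)⁻¹ := by simp [beta]
    rw [e1, e2]
    simp only [L_succ, L_zero, b1, b2]
    by_cases hy0 : y = 0
    · subst hy0
      simp [edgeProb]
      field_simp
      ring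
    by_cases hy1 : y = 1
    · subst hy1
      simp
      right
      ring
    by_cases hy2 : y = 2
    · subst hy2
      simp [edgeProb]
      field_simp
      ring
    · have a1 : y - 1 ≠ 0 := by omega
      have a2 : y - 1 - 1 ≠ 0 := by omega
      simp [hy0, a1, a2]
  | succ r ih =>
    intro u h1 h2 y
    have i1 := ih h1 h2 y
    have i2 := @ih (-u) (by ring_nf; ring_nf at h2; exact h2)
      (by ring_nf; ring_nf at h1; exact h1) (y - 1)
    rw [neg_neg, edgeProb_sub_one, ← edgeProb_neg] at i2
    have s1 := rowFactor_succ_mul_beta h1 h2 r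
    have s3 := rowFactor_beta_relation h1 h2 r
    have hb := beta_ne_zero h1 h2 r
    have he := rowFactor_ne_zero h1 h2 r
    have he' : rowFactor r (-u) ≠ 0 := rowFactor_ne_zero (by ring_nf; ring_nf at h2; exact h2)
      (by ring_nf; ring_nf at h1; exact h1) r
    have F0 := L_succ r y u
    have F1 := L_succ r (y - 1) u
    rw [L_succ (r + 1) y u, L_succ (r + 1) (y - 1) u, L_succ (r + 1) y (-u),
      L_succ (r + 1) (y - 1) (-u), neg_neg]
    generalize L (r + 1) y u = F at *
    generalize L (r + 1) (y - 1) u = F' at *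
    generalize L (r + 1) (y - 1 - 1) u = F'' at *
    generalize L (r + 1) y (-u) = G at *
    generalize L (r + 1) (y - 1) (-u) = G' at *
    generalize L (r + 1) (y - 1 - 1) (-u) = G'' at *
    generalize L r y u = f at *
    generalize L r (y - 1) u = f' at *
    generalize L r (y - 1) (-u) = g' at *
    generalize L r (y - 1 - 1) (-u) = g'' at *
    generalize edgeProb (-u) y = p at *
    generalize (rowFactor (r + 1) (-u))⁻¹ = d at *
    generalize rowFactor (r + 1) u = e2 at *
    generalize rowFactor r u = e at *
    generalize rowFactor r (-u) = e' at *
    generalize beta (r + 1) u = B at *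
    generalize beta (r + 1) (-u) = B' at *
    generalize beta r u = b at *
    have i1' : e' * p * (F + F') - p * (f + f') = -e * e' * (G - G') := by
      have : e' * e'⁻¹ = 1 := mul_inv_cancel₀ he'
      linear_combination e' * i1 + p * (f + f') * this
    have i2' : e * p * (G' + G'') - p * (g' + g'') = -e * e' * (F' - F'') := by
      have : e * e⁻¹ = 1 := mul_inv_cancel₀ he
      linear_combination e * i2 + p * (g' + g'') * this
    have key : (e * b) * (p * ((F + G') * B - d * F + ((F' + G'') * B - d * F')) +
        e2 * B' * ((G + F') - (G' + F''))) = 0 := by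
      linear_combination B * b * i1' + B * b * i2' - B * p * (F0 + F1) +
        p * (F + F') * s3 + (e * b) * ((G + F') - (G' + F'')) * s1
    have := (mul_eq_zero.mp key).resolve_left (mul_ne_zero he hb)
    linear_combination this

/-! ### Summation of determinants over an interlacing level -/

/-- Partial sums of a row of `L`, in which the last entry counts with a fraction. -/
def cumL (r : ℕ) (u : ℝ) (y : ℤ) : ℝ :=
  ∑ z ∈ Finset.Ico 0 y, L r z u + edgeProb (-u) y * L r y u

lemma cumL_add_one (r : ℕ) (u : ℝ) {y : ℤ} (hy : 0 ≤ y) :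
    cumL r u (y + 1) = cumL r u y + edgeProb (-u) (y + 1) * (L r (y + 1) u + L r y u) := by
  have h : Finset.Ico 0 (y + 1) = insert y (Finset.Ico 0 y) := by
    ext z; simp only [Finset.mem_Ico, Finset.mem_insert]; omega
  unfold cumL
  rw [h, Finset.sum_insert (by simp), edgeProb_add_one]
  ring

lemma cumL_succ_sub (r : ℕ) {u : ℝ} (h1 : 1 - 2 * u ≠ 0) (h2 : 1 + 2 * u ≠ 0) {y : ℤ}
    (hy : 0 ≤ y) :
    cumL (r + 1) u y - (rowFactor r (-u))⁻¹ * cumL r u y =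
      -rowFactor r u * L (r + 1) y (-u) := by
  induction y, hy using Int.leInduction with
  | base =>
    have := L_local_relation r h1 h2 0
    simp only [L_eq_zero_of_neg _ (show (0 : ℤ) - 1 < 0 by norm_num)] at this
    simp only [cumL, Finset.Ico_self, Finset.sum_empty]
    linear_combination this
  | succ y hy ih =>
    have := L_local_relation r h1 h2 (y + 1)
    rw [add_sub_cancel_right] at this
    rw [cumL_add_one _ _ hy, cumL_add_one _ _ hy]
    linear_combination ih + this

/-- Beyond the support of row `r`, the partial sum is the whole row sum, a product of inverse
row factors. -/
lemma cumL_of_lt {u : ℝ} (h1 : 1 - 2 * u ≠ 0) (h2 : 1 + 2 * u ≠ 0) {r : ℕ} {y : ℤ}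
    (hy : (r : ℤ) < y) :
    cumL r u y = ∏ s ∈ Finset.range r, (rowFactor s (-u))⁻¹ := by
  induction r with
  | zero =>
    rw [cumL, L_eq_zero_of_lt _ hy, Finset.sum_eq_single 0]
    · simp [L_zero]
    · intro b _ hb
      simp [L_zero, hb]
    · intro h
      exact absurd (Finset.mem_Ico.2 ⟨le_rfl, by simpa using hy⟩) h
  | succ r ih =>
    have h := cumL_succ_sub r h1 h2 (y := y) (by omega)
    rw [L_eq_zero_of_lt _ hy, ih (by push_cast at hy; omega)] at h
    rw [Finset.prod_range_succ]
    linear_combination h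

lemma sum_Icc_weighted_L (r : ℕ) (u : ℝ) {c d : ℤ} (hc : 0 ≤ c) (hcd : c < d) :
    ∑ z ∈ Finset.Icc c d, (if z = d then edgeProb (-u) d else 1) *
      (if z = c then 1 - edgeProb (-u) c else 1) * L r z u = cumL r u d - cumL r u c := by
  have h : Finset.Icc c d = insert d (insert c (Finset.Ioo c d)) := by
    ext z; simp only [Finset.mem_Icc, Finset.mem_insert, Finset.mem_Ioo]; omega
  have h' : Finset.Ico 0 d = Finset.Ico 0 c ∪ insert c (Finset.Ioo c d) := by
    ext z; simp only [Finset.mem_Ico, Finset.mem_union, Finset.mem_insert, Finset.mem_Ioo]; omega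
  have hdisj : Disjoint (Finset.Ico 0 c) (insert c (Finset.Ioo c d)) := by
    rw [Finset.disjoint_left]
    intro z; simp only [Finset.mem_Ico, Finset.mem_insert, Finset.mem_Ioo]; omega
  have hs : ∑ z ∈ Finset.Ioo c d, (if z = d then edgeProb (-u) d else 1) *
      (if z = c then 1 - edgeProb (-u) c else 1) * L r z u = ∑ z ∈ Finset.Ioo c d, L r z u := by
    refine Finset.sum_congr rfl fun z hz => ?_
    rw [Finset.mem_Ioo] at hz
    rw [if_neg hz.2.ne, if_neg hz.1.ne']
    ring
  rw [h, Finset.sum_insert (by simp [hcd.ne']), Finset.sum_insert (by simp), hs, cumL, cumL, h',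
    Finset.sum_union hdisj, Finset.sum_insert (by simp)]
  simp only [if_true, hcd.ne, hcd.ne', if_false]
  ring

lemma sum_Icc_zero_weighted_L (r : ℕ) (u : ℝ) {d : ℤ} (hd : 0 ≤ d) :
    ∑ z ∈ Finset.Icc 0 d, (if z = d then edgeProb (-u) d else 1) * L r z u = cumL r u d := by
  have h : Finset.Icc 0 d = insert d (Finset.Ico 0 d) := by
    ext z; simp only [Finset.mem_Icc, Finset.mem_insert, Finset.mem_Ico]; omega
  have hs : ∑ z ∈ Finset.Ico 0 d, (if z = d then edgeProb (-u) d else 1) * L r z u =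
      ∑ z ∈ Finset.Ico 0 d, L r z u := by
    refine Finset.sum_congr rfl fun z hz => ?_
    rw [Finset.mem_Ico] at hz
    rw [if_neg hz.2.ne, one_mul]
  rw [h, Finset.sum_insert (by simp), hs, cumL, if_pos rfl, add_comm]

lemma sum_Icc_last_weighted_L {r n : ℕ} (hr : r ≤ n) (u : ℝ) {c : ℤ} (hc : 0 ≤ c) (hcn : c ≤ n) :
    ∑ z ∈ Finset.Icc c n, (if z = c then 1 - edgeProb (-u) c else 1) * L r z u =
      cumL r u (n + 1) - cumL r u c := by
  have h : Finset.Icc c ((n : ℤ) + 1) = insert ((n : ℤ) + 1) (Finset.Icc c n) := by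
    ext z; simp only [Finset.mem_Icc, Finset.mem_insert]; omega
  rw [← sum_Icc_weighted_L r u hc (show c < (n : ℤ) + 1 by omega), h,
    Finset.sum_insert (by simp), L_eq_zero_of_lt r (show (r : ℤ) < n + 1 by omega), mul_zero,
    zero_add]
  refine Finset.sum_congr rfl fun z hz => ?_
  rw [Finset.mem_Icc] at hz
  rw [if_neg (show z ≠ n + 1 by omega), one_mul]

/-- Row operations: the determinant of partial sums reduces to a determinant of entries of `L`
of size one less. -/
lemma det_cumL {u : ℝ} (h1 : 1 - 2 * u ≠ 0) (h2 : 1 + 2 * u ≠ 0) (N m : ℕ)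
    (y : Fin (m + 1) → ℤ) (hy : ∀ i, 0 ≤ y i) :
    Matrix.det (Matrix.of fun i j : Fin (m + 2) =>
      cumL (N + i) u (Fin.snoc (α := fun _ => ℤ) y (N + m + 2 : ℤ) j)) =
    (∏ s ∈ Finset.range (N + (m + 1)), rowFactor s u) / ((1 - 4 * u ^ 2) / 4) ^ N *
      Matrix.det (Matrix.of fun i j : Fin (m + 1) => L (N + 1 + i) (y j) (-u)) := by
  set yy : Fin (m + 2) → ℤ := Fin.snoc (α := fun _ => ℤ) y (N + m + 2 : ℤ) with hyy
  have hyy0 : ∀ j, 0 ≤ yy j := by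
    intro j
    induction j using Fin.lastCases with
    | last => rw [hyy, Fin.snoc_last]; positivity
    | cast j => rw [hyy, Fin.snoc_castSucc]; exact hy j
  rw [Matrix.det_eq_of_forall_row_eq_smul_add_pred
    (B := Matrix.of (Fin.cons (fun j => cumL N u (yy j))
      (fun (i : Fin (m + 1)) j => -rowFactor (N + i) u * L (N + i + 1) (yy j) (-u))))
    (fun i : Fin (m + 1) => (rowFactor (N + i) (-u))⁻¹)]
  rotate_left
  · intro j
    simp
  · intro i j
    have := cumL_succ_sub (N + i) h1 h2 (hyy0 j)
    simp only [Matrix.of_apply, Fin.cons_succ, Fin.val_succ, Fin.val_castSucc]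
    rw [← this, add_assoc]
    ring
  -- the last column now vanishes below its first entry, a full row sum
  rw [Matrix.det_succ_column _ (Fin.last (m + 1)), Finset.sum_eq_single 0]
  rotate_left
  · intro i _ hi
    obtain ⟨k, rfl⟩ := Fin.exists_succ_eq.2 hi
    have : L (N + k + 1) (yy (Fin.last (m + 1))) (-u) = 0 := by
      apply L_eq_zero_of_lt
      rw [hyy, Fin.snoc_last]
      have := k.2
      push_cast
      omega
    simp [this]
  · simp
  have hlast : cumL N u (yy (Fin.last (m + 1))) =
      (∏ s ∈ Finset.range N, rowFactor s u) / ((1 - 4 * u ^ 2) / 4) ^ N := by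
    have h1' : 1 - 2 * (-u) ≠ 0 := by ring_nf; ring_nf at h2; exact h2
    have h2' : 1 + 2 * (-u) ≠ 0 := by ring_nf; ring_nf at h1; exact h1
    rw [cumL_of_lt h1 h2 (by rw [hyy, Fin.snoc_last]; omega), ← Finset.card_range N,
      ← Finset.prod_const, Finset.card_range, ← Finset.prod_div_distrib]
    refine Finset.prod_congr rfl fun s _ => ?_
    rw [← rowFactor_mul_neg s u]
    have := rowFactor_ne_zero h1 h2 s
    have := rowFactor_ne_zero h1' h2' s
    field_simp
  have hsub : (Matrix.of (Fin.cons (fun j => cumL N u (yy j))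
      (fun (i : Fin (m + 1)) j => -rowFactor (N + i) u * L (N + i + 1) (yy j) (-u)))).submatrix
      (Fin.succAbove 0) (Fin.succAbove (Fin.last (m + 1))) =
      Matrix.of fun i j : Fin (m + 1) => -rowFactor (N + i) u *
        (Matrix.of fun i j : Fin (m + 1) => L (N + 1 + i) (y j) (-u)) i j := by
    ext i j
    simp only [Matrix.submatrix_apply, Fin.succAbove_zero, Fin.succAbove_last, Matrix.of_apply,
      Fin.cons_succ, hyy, Fin.snoc_castSucc]
    rw [add_right_comm]
  rw [hsub, Matrix.det_mul_column, Finset.prod_neg, Finset.prod_range_add,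
    ← Fin.prod_univ_eq_prod_range (fun i => rowFactor (N + i) u) (m + 1)]
  simp only [Matrix.of_apply, Fin.cons_zero, hlast, Finset.card_univ, Fintype.card_fin,
    Fin.val_zero, Fin.val_last, zero_add]
  have hsq : ((-1 : ℝ) ^ (m + 1)) * (-1) ^ (m + 1) = 1 := by
    rw [← mul_pow]; norm_num
  linear_combination ((∏ s ∈ Finset.range N, rowFactor s u) / ((1 - 4 * u ^ 2) / 4) ^ N *
    (∏ i : Fin (m + 1), rowFactor (N + i) u) *
      Matrix.det (Matrix.of fun i j : Fin (m + 1) => L (N + 1 + i) (y j) (-u))) * hsq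

/-- The strictly increasing `k`-tuples of heights. -/
def heightTuples (n k : ℕ) : Finset (Fin k → ℤ) :=
  {z ∈ Fintype.piFinset fun _ => Finset.Icc (0 : ℤ) n | StrictMono z}

lemma mem_heightTuples {n k : ℕ} {z : Fin k → ℤ} :
    z ∈ heightTuples n k ↔ (∀ i, 0 ≤ z i ∧ z i ≤ n) ∧ StrictMono z := by
  simp [heightTuples]

/-- The interlacing `y ≺ z` of two consecutive levels. -/
def Interlaces {k : ℕ} (y : Fin k → ℤ) (z : Fin (k + 1) → ℤ) : Prop :=
  ∀ i, z i.castSucc ≤ y i ∧ y i ≤ z i.succ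

/-- The weight of a pair of consecutive levels: a particle at the same height as its inferior
neighbour contributes `p`, one at the same height as its superior neighbour contributes `1 - p`. -/
def levelWeight (p : ℤ → ℝ) {k : ℕ} (y : Fin k → ℤ) (z : Fin (k + 1) → ℤ) : ℝ :=
  ∏ i, (if z i.castSucc = y i then p (y i) else 1) * (if z i.succ = y i then 1 - p (y i) else 1)

lemma det_eq_sum_piFinset {k : ℕ} (f : Fin k → ℤ → ℝ) (w : Fin k → ℤ → ℝ)
    (t : Fin k → Finset ℤ) :
    Matrix.det (Matrix.of fun i j => ∑ z ∈ t j, w j z * f i z) =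
      ∑ z ∈ Fintype.piFinset t, (∏ j, w j (z j)) * Matrix.det (Matrix.of fun i j => f i (z j)) := by
  have h := (Matrix.detRowAlternating (R := ℝ) (n := Fin k)).toMultilinearMap.map_sum_finset
    (fun j z => fun i => w j z * f i z) t
  rw [← Matrix.det_transpose]
  have e : (Matrix.of fun i j => ∑ z ∈ t j, w j z * f i z).transpose =
      fun j => ∑ z ∈ t j, fun i => w j z * f i z := by
    ext j i
    simp [Finset.sum_apply]
  rw [e]
  refine h.trans (Finset.sum_congr rfl fun z _ => ?_)
  rw [← Matrix.det_transpose (Matrix.of fun i j => f i (z j)), ← Matrix.det_mul_column]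
  rfl

/-- Summing the upper level against the interlacing weights turns a determinant of `L` of size
`m + 2` into one of size `m + 1`, with the sign of the parameter reversed. Tuples `z` in the box
cut out by the interlacing inequalities which are not strictly increasing may be included, since
their determinants have two equal columns; multilinearity then turns the sum into the determinant
of `det_cumL`, up to column operations. -/
lemma sum_levelWeight_mul_det {u : ℝ} (h1 : 1 - 2 * u ≠ 0) (h2 : 1 + 2 * u ≠ 0) {n N m : ℕ}
    (hn : n = N + (m + 1)) {y : Fin (m + 1) → ℤ} (hy : y ∈ heightTuples n (m + 1)) :
    (open Classical in
    ∑ z ∈ heightTuples n (m + 2) with Interlaces y z, levelWeight (edgeProb (-u)) y z *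
      Matrix.det (Matrix.of fun i j : Fin (m + 2) => L (N + i) (z j) u)) =
    (∏ s ∈ Finset.range n, rowFactor s u) / ((1 - 4 * u ^ 2) / 4) ^ N *
      Matrix.det (Matrix.of fun i j : Fin (m + 1) => L (N + 1 + i) (y j) (-u)) := by
  classical
  obtain ⟨hyb, hys⟩ := mem_heightTuples.1 hy
  rw [hn, ← det_cumL h1 h2 N m y (fun i => (hyb i).1)]
  set p := edgeProb (-u) with hp
  set lo : Fin (m + 2) → ℤ := Fin.cons (α := fun _ => ℤ) 0 y with hlo
  set hi : Fin (m + 2) → ℤ := Fin.snoc (α := fun _ => ℤ) y (n : ℤ) with hhi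
  set wl : Fin (m + 2) → ℝ := Fin.cons (α := fun _ => ℝ) 1 (fun i => 1 - p (y i)) with hwl
  set wh : Fin (m + 2) → ℝ := Fin.snoc (α := fun _ => ℝ) (fun i => p (y i)) 1 with hwh
  set t : Fin (m + 2) → Finset ℤ := fun j => Finset.Icc (lo j) (hi j) with ht
  set w : Fin (m + 2) → ℤ → ℝ := fun j z =>
    (if z = hi j then wh j else 1) * (if z = lo j then wl j else 1) with hw
  have hbox : ∀ z : Fin (m + 2) → ℤ, z ∈ Fintype.piFinset t ↔
      0 ≤ z 0 ∧ z (Fin.last _) ≤ n ∧ Interlaces y z := by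
    intro z
    rw [Fintype.mem_piFinset]
    simp only [ht, Finset.mem_Icc, Interlaces, forall_and]
    rw [Fin.forall_fin_succ, Fin.forall_fin_succ' (P := fun i => z i ≤ hi i)]
    simp only [hlo, hhi, Fin.cons_zero, Fin.cons_succ, Fin.snoc_castSucc, Fin.snoc_last]
    tauto
  have hprod : ∀ z : Fin (m + 2) → ℤ, ∏ j, w j (z j) = levelWeight p y z := by
    intro z
    rw [hw, levelWeight, Finset.prod_mul_distrib, Finset.prod_mul_distrib, Fin.prod_univ_castSucc,
      Fin.prod_univ_succ (fun j => if z j = lo j then wl j else 1)]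
    simp only [hlo, hhi, hwl, hwh, Fin.cons_zero, Fin.cons_succ, Fin.snoc_castSucc, Fin.snoc_last,
      ite_self, mul_one, one_mul]
  have hsum : (∑ z ∈ heightTuples (N + (m + 1)) (m + 2) with Interlaces y z, levelWeight p y z *
      Matrix.det (Matrix.of fun i j : Fin (m + 2) => L (N + i) (z j) u)) =
      ∑ z ∈ Fintype.piFinset t, (∏ j, w j (z j)) *
        Matrix.det (Matrix.of fun i j : Fin (m + 2) => L (N + i) (z j) u) := by
    simp only [hprod]
    refine Finset.sum_subset ?_ ?_
    · intro z hz
      rw [Finset.mem_filter, mem_heightTuples, ← hn] at hz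
      exact (hbox z).2 ⟨(hz.1.1 _).1, (hz.1.1 _).2, hz.2⟩
    · intro z hz hz'
      obtain ⟨hz0, hzn, hzi⟩ := (hbox z).1 hz
      have hmono : Monotone z := by
        rw [Fin.monotone_iff_le_succ]
        exact fun i => (hzi i).1.trans (hzi i).2
      have hns : ¬ StrictMono z := by
        intro hs
        refine hz' (Finset.mem_filter.2 ⟨mem_heightTuples.2 ⟨fun i => ?_, hs⟩, hzi⟩)
        rw [← hn]
        exact ⟨hz0.trans (hmono (Fin.zero_le i)), (hmono (Fin.le_last i)).trans hzn⟩
      rw [Fin.strictMono_iff_lt_succ] at hns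
      push Not at hns
      obtain ⟨i, hi⟩ := hns
      have heq : z i.castSucc = z i.succ := le_antisymm ((hzi i).1.trans (hzi i).2) hi
      rw [Matrix.det_zero_of_column_eq (i := i.castSucc) (j := i.succ) (Fin.castSucc_lt_succ).ne,
        mul_zero]
      intro k
      simp [heq]
  rw [hsum, ← det_eq_sum_piFinset (fun (i : Fin (m + 2)) z => L (N + i) z u) w t]
  symm
  apply Matrix.det_eq_of_forall_col_eq_smul_add_pred (fun _ => 1)
  · intro i
    have e0 : (Fin.snoc (α := fun _ => ℤ) y (N + m + 2 : ℤ) (0 : Fin (m + 2))) = y 0 :=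
      Fin.snoc_castSucc (α := fun _ => ℤ) (x := (N + m + 2 : ℤ)) (p := y) (i := 0)
    have e1 : hi 0 = y 0 :=
      Fin.snoc_castSucc (α := fun _ => ℤ) (x := (n : ℤ)) (p := y) (i := 0)
    have e2 : wh 0 = p (y 0) :=
      Fin.snoc_castSucc (α := fun _ => ℝ) (x := (1 : ℝ)) (p := fun i => p (y i)) (i := 0)
    simp only [Matrix.of_apply, e0, ht, hw, e1, e2]
    rw [hlo, hwl, Fin.cons_zero, Fin.cons_zero, ← sum_Icc_zero_weighted_L (N + i) u (hyb 0).1]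
    simp only [ite_self, mul_one, hp]
  · intro i j
    simp only [Matrix.of_apply, Fin.snoc_castSucc, one_mul, ht, hw]
    rw [hlo, hwl, Fin.cons_succ, Fin.cons_succ, ← sub_eq_iff_eq_add]
    induction j using Fin.lastCases with
    | last =>
      rw [Fin.succ_last, hhi, hwh, Fin.snoc_last, Fin.snoc_last, Fin.snoc_last]
      have := sum_Icc_last_weighted_L (r := N + i) (n := n) (by have := i.2; omega) u
        (hyb (Fin.last m)).1 (hyb (Fin.last m)).2
      simp only [ite_self, one_mul]
      rw [this, hn]
      push_cast
      ring_nf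
    | cast j =>
      rw [Fin.succ_castSucc, hhi, hwh, Fin.snoc_castSucc, Fin.snoc_castSucc, Fin.snoc_castSucc]
      exact (sum_Icc_weighted_L (N + i) u (hyb _).1 (hys (Fin.castSucc_lt_succ))).symm

/-! ### The weighted number of dimer coverings of one column -/

/-- The height of the site to which the vertex at height `k` of a column is matched, when `s.2` tells
whether the dimer goes upwards. The component `s.1` tells whether the dimer goes to the level on
the left. -/
def target (k : ℕ) (s : Bool × Bool) : ℕ := k + s.2.toNat

/-- The number of dimers of a column that cover the site at height `j` on the left (`s = true`) or
on the right (`s = false`). -/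
def coverCount {N : ℕ} (e : Fin N → Bool × Bool) (s : Bool) (j : ℕ) : ℕ :=
  ∑ k : Fin N, if (e k).1 = s ∧ target k (e k) = j then 1 else 0

lemma coverCount_cons_zero {N : ℕ} (e₀ : Bool × Bool) (e : Fin N → Bool × Bool) (s : Bool) :
    coverCount (Fin.cons (α := fun _ => Bool × Bool) e₀ e) s 0 =
      if e₀.1 = s ∧ e₀.2 = false then 1 else 0 := by
  simp only [coverCount, Fin.sum_univ_succ, target, Fin.cons_zero, Fin.cons_succ, Fin.val_zero,
    Fin.val_succ]
  simp

lemma coverCount_cons_succ {N : ℕ} (e₀ : Bool × Bool) (e : Fin N → Bool × Bool) (s : Bool)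
    (j : ℕ) :
    coverCount (Fin.cons (α := fun _ => Bool × Bool) e₀ e) s (j + 1) =
      (if j = 0 then (if e₀.1 = s ∧ e₀.2 = true then 1 else 0) else 0) + coverCount e s j := by
  simp only [coverCount, Fin.sum_univ_succ, target, Fin.cons_zero, Fin.cons_succ, Fin.val_zero,
    Fin.val_succ, zero_add]
  congr 1
  · obtain ⟨a, c⟩ := e₀
    cases c <;> by_cases hj : j = 0 <;> simp [hj, eq_comm]
  · refine Finset.sum_congr rfl fun k _ => ?_
    have : ((k : ℕ) + 1 + (e k).2.toNat = j + 1) ↔ ((k : ℕ) + (e k).2.toNat = j) := by omega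
    exact if_congr (and_congr_right fun _ => this) rfl rfl

/-- The dimers of a column cover exactly the sites in `X` on the left and exactly the sites outside
`Y` on the right, where the site at height `0` is already covered `inL` times on the left and `inR`
times on the right. -/
def ColumnCover {N : ℕ} (X Y : ℕ → Bool) (inL inR : ℕ) (e : Fin N → Bool × Bool) : Prop :=
  ∀ j ≤ N, (if j = 0 then inL else 0) + coverCount e true j = (X j).toNat ∧
    (if j = 0 then inR else 0) + coverCount e false j = (!Y j).toNat

lemma columnCover_cons {N : ℕ} (X Y : ℕ → Bool) (inL inR : ℕ) (e₀ : Bool × Bool)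
    (e : Fin N → Bool × Bool) :
    ColumnCover X Y inL inR (Fin.cons (α := fun _ => Bool × Bool) e₀ e) ↔
      (inL + (if e₀.1 = true ∧ e₀.2 = false then 1 else 0) = (X 0).toNat ∧
        inR + (if e₀.1 = false ∧ e₀.2 = false then 1 else 0) = (!Y 0).toNat) ∧
      ColumnCover (fun j => X (j + 1)) (fun j => Y (j + 1))
        (if e₀.1 = true ∧ e₀.2 = true then 1 else 0)
        (if e₀.1 = false ∧ e₀.2 = true then 1 else 0) e := by
  constructor
  · intro h
    refine ⟨?_, fun j hj => ?_⟩
    · simpa only [coverCount_cons_zero, if_true] using h 0 (by omega)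
    · simpa only [coverCount_cons_succ, Nat.succ_ne_zero, if_false, zero_add] using
        h (j + 1) (by omega)
  · rintro ⟨h0, h⟩ j hj
    cases j with
    | zero => simpa only [coverCount_cons_zero, if_true] using h0
    | succ j =>
      simpa only [coverCount_cons_succ, Nat.succ_ne_zero, if_false, zero_add] using
        h j (by omega)

open Classical in
/-- The weighted number of coverings of a column. -/
def columnSum (N : ℕ) (X Y : ℕ → Bool) (p : ℕ → ℝ) (inL inR : ℕ) : ℝ :=
  ∑ e : Fin N → Bool × Bool with ColumnCover X Y inL inR e, ∏ k : Fin N, if (e k).1 then p k else 1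

lemma columnSum_zero (X Y : ℕ → Bool) (p : ℕ → ℝ) (inL inR : ℕ) :
    columnSum 0 X Y p inL inR = if inL = (X 0).toNat ∧ inR = (!Y 0).toNat then 1 else 0 := by
  rw [columnSum, Finset.sum_filter, Fintype.sum_unique]
  simp [ColumnCover, coverCount]

open Classical in
lemma columnSum_succ (N : ℕ) (X Y : ℕ → Bool) (p : ℕ → ℝ) (inL inR : ℕ) :
    columnSum (N + 1) X Y p inL inR = ∑ e₀ : Bool × Bool,
      if inL + (if e₀.1 = true ∧ e₀.2 = false then 1 else 0) = (X 0).toNat ∧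
        inR + (if e₀.1 = false ∧ e₀.2 = false then 1 else 0) = (!Y 0).toNat then
      (if e₀.1 then p 0 else 1) * columnSum N (fun j => X (j + 1)) (fun j => Y (j + 1))
        (fun j => p (j + 1)) (if e₀.1 = true ∧ e₀.2 = true then 1 else 0)
        (if e₀.1 = false ∧ e₀.2 = true then 1 else 0) else 0 := by
  rw [columnSum, Finset.sum_filter,
    ← Equiv.sum_comp (Fin.consEquiv (fun _ : Fin (N + 1) => Bool × Bool)), Fintype.sum_prod_type]
  refine Finset.sum_congr rfl fun e₀ _ => ?_
  simp only [Fin.consEquiv, Equiv.coe_fn_mk, columnCover_cons, Fin.prod_univ_succ, Fin.cons_zero,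
    Fin.cons_succ, Fin.val_zero, Fin.val_succ]
  rw [columnSum, Finset.sum_filter, Finset.mul_sum]
  by_cases h : inL + (if e₀.1 = true ∧ e₀.2 = false then 1 else 0) = (X 0).toNat ∧
        inR + (if e₀.1 = false ∧ e₀.2 = false then 1 else 0) = (!Y 0).toNat
  · simp only [h, true_and, if_true]
    simp
  · simp only [h, false_and, if_false, Finset.sum_const_zero]

/-- The excess `d + #{i < j | i ∈ Y} - #{i < j | i ∈ X}`. In a covering of a column, it is `1` if
the `(j - 1)`-st dimer goes upwards and `0` otherwise. -/
def excess (X Y : ℕ → Bool) (d : ℤ) (j : ℕ) : ℤ :=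
  d + ∑ i ∈ Finset.range j, (((Y i).toNat : ℤ) - (X i).toNat)

lemma excess_succ (X Y : ℕ → Bool) (d : ℤ) (j : ℕ) :
    excess X Y d (j + 1) = excess (fun i => X (i + 1)) (fun i => Y (i + 1))
      (d + (((Y 0).toNat : ℤ) - (X 0).toNat)) j := by
  rw [excess, excess, Finset.sum_range_succ']
  ring

/-- The contribution of one height to the weight of a column, in terms of the excess `d`. -/
def heightWeight (X Y : Bool) (p : ℝ) (d : ℤ) : ℝ :=
  if X = true ∧ Y = true then (if d = 0 then p else 1 - p) else 1

open Classical in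
/-- The closed form of `columnSum`. -/
def columnWeight (N : ℕ) (X Y : ℕ → Bool) (p : ℕ → ℝ) (d : ℤ) : ℝ :=
  if (∀ j ≤ N + 1, 0 ≤ excess X Y d j ∧ excess X Y d j ≤ 1) ∧ excess X Y d (N + 1) = 1 then
    ∏ j ∈ Finset.range (N + 1), heightWeight (X j) (Y j) (p j) (excess X Y d j) else 0

lemma columnWeight_zero (X Y : ℕ → Bool) (p : ℕ → ℝ) (d : ℤ) :
    columnWeight 0 X Y p d = if 0 ≤ d ∧ d ≤ 1 ∧ d + (((Y 0).toNat : ℤ) - (X 0).toNat) = 1 then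
      heightWeight (X 0) (Y 0) (p 0) d else 0 := by
  have : (∀ j ≤ 0 + 1, 0 ≤ excess X Y d j ∧ excess X Y d j ≤ 1) ∧ excess X Y d (0 + 1) = 1 ↔
      0 ≤ d ∧ d ≤ 1 ∧ d + (((Y 0).toNat : ℤ) - (X 0).toNat) = 1 := by
    constructor
    · rintro ⟨h, h'⟩
      have := h 0 (by omega)
      simp only [excess, Finset.range_zero, Finset.sum_empty, add_zero, zero_add,
        Finset.sum_range_one] at this h'
      exact ⟨this.1, this.2, h'⟩
    · rintro ⟨h0, h1, h2⟩
      have h2' : excess X Y d (0 + 1) = 1 := by simpa [excess] using h2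
      refine ⟨fun j hj => ?_, h2'⟩
      interval_cases j
      · simpa [excess] using ⟨h0, h1⟩
      · rw [zero_add] at h2'
        rw [h2']; simp
  simp only [columnWeight, this]
  simp [excess]

lemma columnWeight_succ (N : ℕ) (X Y : ℕ → Bool) (p : ℕ → ℝ) (d : ℤ) :
    columnWeight (N + 1) X Y p d = if 0 ≤ d ∧ d ≤ 1 then heightWeight (X 0) (Y 0) (p 0) d *
      columnWeight N (fun i => X (i + 1)) (fun i => Y (i + 1)) (fun i => p (i + 1))
        (d + (((Y 0).toNat : ℤ) - (X 0).toNat)) else 0 := by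
  have h0 : excess X Y d 0 = d := by simp [excess]
  have : ((∀ j ≤ N + 1 + 1, 0 ≤ excess X Y d j ∧ excess X Y d j ≤ 1) ∧
      excess X Y d (N + 1 + 1) = 1) ↔ (0 ≤ d ∧ d ≤ 1) ∧
      ((∀ j ≤ N + 1, 0 ≤ excess X Y d (j + 1) ∧ excess X Y d (j + 1) ≤ 1) ∧
      excess X Y d (N + 1 + 1) = 1) := by
    constructor
    · rintro ⟨h, h'⟩
      exact ⟨by simpa [h0] using h 0 (by omega), fun j hj => h (j + 1) (by omega), h'⟩
    · rintro ⟨hd, h, h'⟩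
      refine ⟨fun j hj => ?_, h'⟩
      cases j with
      | zero => rwa [h0]
      | succ j => exact h j (by omega)
  simp only [columnWeight, this, Finset.prod_range_succ' _ (N + 1), h0, ← excess_succ]
  by_cases h : 0 ≤ d ∧ d ≤ 1
  · simp only [h, true_and, if_true, and_self]
    split_ifs <;> ring
  · simp only [h, false_and, if_false]

lemma columnWeight_eq_zero (N : ℕ) (X Y : ℕ → Bool) (p : ℕ → ℝ) {d : ℤ} (hd : ¬ (0 ≤ d ∧ d ≤ 1)) :
    columnWeight N X Y p d = 0 := by
  rw [columnWeight, if_neg]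
  intro h
  exact hd (by simpa [excess] using h.1 0 (by omega))

/-- The sum over all coverings of a column, computed from the bottom upwards. The first statement
concerns a column in which no dimer reaches the height `0` from below, the second one a column with
such a dimer, of weight `1 - p 0` or `1` according to its side. -/
lemma columnSum_eq_columnWeight (N : ℕ) : ∀ (X Y : ℕ → Bool) (p : ℕ → ℝ),
    (∀ k, p (k + 1) = 1 - p k) →
    columnSum N X Y p 0 0 = columnWeight N X Y p 0 ∧
    (1 - p 0) * columnSum N X Y p 1 0 + columnSum N X Y p 0 1 = columnWeight N X Y p 1 := by
  induction N with
  | zero =>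
    intro X Y p hp
    simp only [columnSum_zero, columnWeight_zero, heightWeight]
    cases X 0 <;> cases Y 0 <;> simp
  | succ N ih =>
    intro X Y p hp
    obtain ⟨i0, i1⟩ := ih (fun j => X (j + 1)) (fun j => Y (j + 1)) (fun j => p (j + 1))
      (fun k => hp (k + 1))
    rw [zero_add, hp 0, sub_sub_cancel] at i1
    have z1 := columnWeight_eq_zero N (fun j => X (j + 1)) (fun j => Y (j + 1))
      (fun j => p (j + 1)) (d := -1) (by norm_num)
    have z2 := columnWeight_eq_zero N (fun j => X (j + 1)) (fun j => Y (j + 1))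
      (fun j => p (j + 1)) (d := 2) (by norm_num)
    simp only [columnSum_succ, columnWeight_succ, Fintype.sum_prod_type, Fintype.sum_bool,
      heightWeight]
    rcases Bool.eq_false_or_eq_true (X 0) with hX | hX <;>
    rcases Bool.eq_false_or_eq_true (Y 0) with hY | hY <;>
    · norm_num [hX, hY, i0, ← i1, z1, z2]
      try ring

open Classical in
/-- The occupation function of a tuple of heights. -/
def occupied {k : ℕ} (x : Fin k → ℤ) (j : ℕ) : Bool := decide (∃ i, x i = j)

lemma occupied_eq_true {k : ℕ} {x : Fin k → ℤ} {j : ℕ} :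
    occupied x j = true ↔ ∃ i, x i = j := by
  simp [occupied]

/-- The number of entries of a tuple below `t`. -/
def countBelow {k : ℕ} (x : Fin k → ℤ) (t : ℤ) : ℕ := Finset.card {i | x i < t}

lemma lt_countBelow_iff {k : ℕ} {x : Fin k → ℤ} (hx : StrictMono x) (i : Fin k) (t : ℤ) :
    (i : ℕ) < countBelow x t ↔ x i < t := by
  constructor
  · intro h
    by_contra hi
    have : ({i | x i < t} : Finset (Fin k)) ⊆ Finset.Iio i := by
      intro j hj
      rw [Finset.mem_filter] at hj
      rw [Finset.mem_Iio, ← hx.lt_iff_lt]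
      omega
    have := Finset.card_le_card this
    rw [Fin.card_Iio] at this
    exact absurd h (not_lt.2 this)
  · intro h
    have : Finset.Iic i ⊆ ({i | x i < t} : Finset (Fin k)) := by
      intro j hj
      rw [Finset.mem_Iic] at hj
      rw [Finset.mem_filter]
      exact ⟨Finset.mem_univ _, (hx.monotone hj).trans_lt h⟩
    have := Finset.card_le_card this
    rw [Fin.card_Iic] at this
    exact this

lemma countBelow_le {k : ℕ} (x : Fin k → ℤ) (t : ℤ) : countBelow x t ≤ k :=
  (Finset.card_le_univ _).trans (Fintype.card_fin k).le

lemma countBelow_apply {k : ℕ} {x : Fin k → ℤ} (hx : StrictMono x) (i : Fin k) :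
    countBelow x (x i) = i := by
  have : ({j | x j < x i} : Finset (Fin k)) = Finset.Iio i := by
    ext j
    simp [hx.lt_iff_lt]
  rw [countBelow, this, Fin.card_Iio]

lemma sum_occupied {k : ℕ} {x : Fin k → ℤ} (hx : StrictMono x) (hx0 : ∀ i, 0 ≤ x i) (j : ℕ) :
    ∑ i ∈ Finset.range j, ((occupied x i).toNat : ℤ) = countBelow x j := by
  have : (({i | x i < j} : Finset (Fin k)).image fun i => (x i).toNat) =
      {i ∈ Finset.range j | occupied x i = true} := by
    ext t
    simp only [Finset.mem_image, Finset.mem_filter, Finset.mem_univ, true_and, Finset.mem_range,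
      occupied_eq_true]
    constructor
    · rintro ⟨i, hi, rfl⟩
      have := hx0 i
      exact ⟨by omega, i, by omega⟩
    · rintro ⟨ht, i, hi⟩
      exact ⟨i, by omega, by omega⟩
  rw [countBelow, ← Finset.card_image_of_injective _ (f := fun i => (x i).toNat), this,
    Finset.card_filter, Nat.cast_sum]
  · refine Finset.sum_congr rfl fun i _ => ?_
    cases occupied x i <;> simp
  · intro i i' h
    have h1 := hx0 i
    have h2 := hx0 i'
    simp only at h
    exact hx.injective (by omega)

lemma excess_occupied {k l : ℕ} {x : Fin k → ℤ} {y : Fin l → ℤ} (hx : StrictMono x)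
    (hx0 : ∀ i, 0 ≤ x i) (hy : StrictMono y) (hy0 : ∀ i, 0 ≤ y i) (j : ℕ) :
    excess (occupied x) (occupied y) 0 j = countBelow y j - countBelow x j := by
  rw [excess, Finset.sum_sub_distrib, sum_occupied hx hx0, sum_occupied hy hy0, zero_add]

lemma countBelow_of_interlaces {k : ℕ} {x : Fin k → ℤ} {y : Fin (k + 1) → ℤ} (hx : StrictMono x)
    (hy : StrictMono y) (h : Interlaces x y) (t : ℤ) :
    countBelow x t ≤ countBelow y t ∧ countBelow y t ≤ countBelow x t + 1 := by
  constructor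
  · by_contra hc
    push Not at hc
    have hk := countBelow_le x t
    have h1 := (lt_countBelow_iff hx ⟨countBelow y t, by omega⟩ t).1 hc
    have h2 := (lt_countBelow_iff hy (Fin.castSucc ⟨countBelow y t, by omega⟩) t).2
      ((h _).1.trans_lt h1)
    simp at h2
  · by_contra hc
    push Not at hc
    have hk := countBelow_le y t
    have h1 := (lt_countBelow_iff hy (Fin.succ ⟨countBelow x t, by omega⟩) t).1 hc
    have h2 := (lt_countBelow_iff hx ⟨countBelow x t, by omega⟩ t).2
      ((h _).2.trans_lt h1)
    simp at h2

/-- Two levels interlace precisely when the excess stays in `{0, 1}`. -/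
lemma interlaces_iff_excess {N k : ℕ} {x : Fin k → ℤ} {y : Fin (k + 1) → ℤ}
    (hx : x ∈ heightTuples N k) (hy : y ∈ heightTuples N (k + 1)) :
    Interlaces x y ↔
      (∀ j ≤ N + 1, 0 ≤ excess (occupied x) (occupied y) 0 j ∧
        excess (occupied x) (occupied y) 0 j ≤ 1) ∧
      excess (occupied x) (occupied y) 0 (N + 1) = 1 := by
  obtain ⟨hxb, hxs⟩ := mem_heightTuples.1 hx
  obtain ⟨hyb, hys⟩ := mem_heightTuples.1 hy
  have hex := excess_occupied hxs (fun i => (hxb i).1) hys (fun i => (hyb i).1)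
  constructor
  · intro h
    refine ⟨fun j _ => ?_, ?_⟩
    · have := countBelow_of_interlaces hxs hys h j
      rw [hex]
      omega
    · have e1 : countBelow x ((N + 1 : ℕ) : ℤ) = k := by
        rw [countBelow, Finset.filter_true_of_mem]
        · simp
        · intro i _
          have := (hxb i).2
          push_cast
          omega
      have e2 : countBelow y ((N + 1 : ℕ) : ℤ) = k + 1 := by
        rw [countBelow, Finset.filter_true_of_mem]
        · simp
        · intro i _
          have := (hyb i).2
          push_cast
          omega
      rw [hex, e1, e2]
      push_cast
      ring
  · rintro ⟨h, -⟩ i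
    constructor
    · have hb := hxb i
      have hj := h ((x i).toNat + 1) (by omega)
      have e : (((x i).toNat + 1 : ℕ) : ℤ) = x i + 1 := by push_cast; omega
      rw [hex, e] at hj
      have h1 := (lt_countBelow_iff hxs i (x i + 1)).2 (by omega)
      have h2 := (lt_countBelow_iff hys i.castSucc (x i + 1)).1 (by rw [Fin.val_castSucc]; omega)
      omega
    · by_contra hc
      push Not at hc
      have hb := hyb i.succ
      have hj := h ((y i.succ).toNat + 1) (by omega)
      have e : (((y i.succ).toNat + 1 : ℕ) : ℤ) = y i.succ + 1 := by push_cast; omega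
      rw [hex, e] at hj
      have h1 := (lt_countBelow_iff hys i.succ (y i.succ + 1)).2 (by omega)
      have h2 := mt (lt_countBelow_iff hxs i (y i.succ + 1)).1 (by omega)
      rw [Fin.val_succ] at h1
      omega

lemma heightWeight_of_interlaces {k : ℕ} {x : Fin k → ℤ} {y : Fin (k + 1) → ℤ}
    (hx : StrictMono x) (hx0 : ∀ i, 0 ≤ x i) (hy : StrictMono y) (hy0 : ∀ i, 0 ≤ y i)
    (h : Interlaces x y) (p : ℝ) (i : Fin k) :
    heightWeight true (occupied y (x i).toNat) p
      (excess (occupied x) (occupied y) 0 (x i).toNat) =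
    (if y i.castSucc = x i then p else 1) * (if y i.succ = x i then 1 - p else 1) := by
  have e : (((x i).toNat : ℕ) : ℤ) = x i := by have := hx0 i; omega
  have hlt : y i.castSucc < y i.succ := hy Fin.castSucc_lt_succ
  rw [excess_occupied hx hx0 hy hy0, e, countBelow_apply hx, heightWeight]
  by_cases h1 : y i.castSucc = x i
  · have ho : occupied y (x i).toNat = true := occupied_eq_true.2 ⟨_, h1.trans e.symm⟩
    have h2 : y i.succ ≠ x i := by omega
    have h3 : countBelow y (x i) = i := by
      rw [← h1, countBelow_apply hy, Fin.val_castSucc]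
    rw [if_pos h1, if_neg h2, ho, h3]
    simp
  by_cases h2 : y i.succ = x i
  · have ho : occupied y (x i).toNat = true := occupied_eq_true.2 ⟨_, h2.trans e.symm⟩
    have h3 : countBelow y (x i) = i + 1 := by
      rw [← h2, countBelow_apply hy, Fin.val_succ]
    rw [if_neg h1, if_pos h2, ho, h3]
    simp
  · have ho : ¬ (occupied y (x i).toNat = true) := by
      rw [occupied_eq_true]
      rintro ⟨l, hl⟩
      rw [e] at hl
      have a1 : i.castSucc < l := by
        rw [← hy.lt_iff_lt]
        exact lt_of_le_of_ne ((h i).1.trans hl.ge) (by rwa [hl])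
      have a2 : l < i.succ := by
        rw [← hy.lt_iff_lt]
        exact lt_of_le_of_ne (hl.le.trans (h i).2) (by rw [hl]; exact fun h => h2 h.symm)
      rw [Fin.lt_def, Fin.val_castSucc] at a1
      rw [Fin.lt_def, Fin.val_succ] at a2
      omega
    rw [if_neg h1, if_neg h2, if_neg (fun h => ho h.2), one_mul]

/-- The weighted number of coverings of the column between two given consecutive levels. -/
lemma columnSum_occupied {N k : ℕ} {x : Fin k → ℤ} {y : Fin (k + 1) → ℤ}
    (hx : x ∈ heightTuples N k) (hy : y ∈ heightTuples N (k + 1)) {p : ℤ → ℝ}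
    (hp : ∀ t, p (t + 1) = 1 - p t) :
    columnSum N (occupied x) (occupied y) (fun j => p j) 0 0 =
      (open Classical in if Interlaces x y then levelWeight p x y else 0) := by
  obtain ⟨hxb, hxs⟩ := mem_heightTuples.1 hx
  obtain ⟨hyb, hys⟩ := mem_heightTuples.1 hy
  rw [(columnSum_eq_columnWeight N _ _ _ (fun j => by push_cast; exact hp j)).1, columnWeight]
  have hi := interlaces_iff_excess hx hy
  by_cases h : Interlaces x y
  · rw [if_pos (hi.1 h), if_pos h, levelWeight]
    have : Finset.univ.image (fun i => (x i).toNat) =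
        {j ∈ Finset.range (N + 1) | occupied x j = true} := by
      ext t
      simp only [Finset.mem_image, Finset.mem_filter, Finset.mem_univ, true_and, Finset.mem_range,
        occupied_eq_true]
      constructor
      · rintro ⟨i, rfl⟩
        have := hxb i
        exact ⟨by omega, i, by omega⟩
      · rintro ⟨ht, i, hi⟩
        exact ⟨i, by omega⟩
    rw [← Finset.prod_filter_of_ne (p := fun j => occupied x j = true), ← this,
      Finset.prod_image]
    · refine Finset.prod_congr rfl fun i _ => ?_
      have e : (((x i).toNat : ℕ) : ℤ) = x i := by have := hxb i; omega
      rw [← heightWeight_of_interlaces hxs (fun i => (hxb i).1) hys (fun i => (hyb i).1) h,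
        (occupied_eq_true (x := x)).2 ⟨i, e.symm⟩, e]
    · intro i _ i' _ h
      have h1 := hxb i
      have h2 := hxb i'
      simp only at h
      exact hxs.injective (by omega)
    · intro j _ hj
      by_contra ho
      exact hj (by rw [heightWeight, if_neg (fun h => ho h.1)])
  · rw [if_neg (fun h' => h (hi.2 h')), if_neg h]

/-! ### Coordinates on the graph -/

lemma mem_vertices {n : ℕ} {p : ℤ × ℤ} : p ∈ vertices n ↔
    (n : ℤ) - 1 ≤ p.1 + p.2 ∧ p.1 + p.2 ≤ 3 * n - 1 ∧ -(n : ℤ) ≤ p.1 - p.2 ∧ p.1 - p.2 ≤ n := by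
  simp only [vertices, Finset.mem_filter, Finset.mem_product, Finset.mem_Icc]
  rcases abs_cases (2 * p.1 - (2 * (n : ℤ) - 1)) with ⟨h, _⟩ | ⟨h, _⟩ <;>
  rcases abs_cases (2 * p.2 - (2 * (n : ℤ) - 1)) with ⟨h', _⟩ | ⟨h', _⟩ <;>
  rw [h, h'] <;> omega

lemma abs_add_abs_eq_one {x y : ℤ} : |x| + |y| = 1 ↔
    (x = 1 ∧ y = 0) ∨ (x = -1 ∧ y = 0) ∨ (x = 0 ∧ y = 1) ∨ (x = 0 ∧ y = -1) := by
  rcases abs_cases x with ⟨h, _⟩ | ⟨h, _⟩ <;>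
  rcases abs_cases y with ⟨h', _⟩ | ⟨h', _⟩ <;>
  rw [h, h'] <;> omega

/-- The vertices that are not sites: the vertex at height `k` of column `ℓ`, between the levels `ℓ`
and `ℓ + 1`. -/
def darkPoint (n ℓ k : ℕ) : ℤ × ℤ := ((ℓ : ℤ) + k, (n : ℤ) - ℓ + k)

/-- The site to which `darkPoint n ℓ k` is matched by a dimer in the direction `s`. -/
def matePoint (n ℓ k : ℕ) (s : Bool × Bool) : ℤ × ℤ :=
  site n (ℓ + (!s.1).toNat) (target k s)

lemma darkPoint_mem {n : ℕ} (ℓ : Fin (n + 1)) (k : Fin n) : darkPoint n ℓ k ∈ vertices n := by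
  have := ℓ.2
  have := k.2
  rw [mem_vertices, darkPoint]
  dsimp only
  omega

lemma site_mem {n ℓ j : ℕ} (h1 : 1 ≤ ℓ) (h2 : ℓ ≤ n) (hj : j ≤ n) :
    site n ℓ j ∈ vertices n := by
  rw [mem_vertices, site]
  dsimp only
  omega

lemma site_mem_iff {n ℓ : ℕ} {j : ℤ} :
    site n ℓ j ∈ vertices n ↔ (1 ≤ ℓ ∧ ℓ ≤ n) ∧ 0 ≤ j ∧ j ≤ n := by
  rw [mem_vertices, site]
  dsimp only
  omega

lemma darkPoint_injective {n ℓ k ℓ' k' : ℕ} (h : darkPoint n ℓ k = darkPoint n ℓ' k') :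
    ℓ = ℓ' ∧ k = k' := by
  simp only [darkPoint, Prod.mk.injEq] at h
  omega

lemma site_injective {n ℓ ℓ' : ℕ} {k k' : ℤ} (h : site n ℓ k = site n ℓ' k') :
    ℓ = ℓ' ∧ k = k' := by
  simp only [site, Prod.mk.injEq] at h
  omega

lemma darkPoint_ne_site {n ℓ k ℓ' : ℕ} {k' : ℤ} : darkPoint n ℓ k ≠ site n ℓ' k' := by
  intro h
  simp only [site, darkPoint, Prod.mk.injEq] at h
  omega

lemma exists_darkPoint_or_site {n : ℕ} {p : ℤ × ℤ} (hp : p ∈ vertices n) :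
    (∃ (ℓ : Fin (n + 1)) (k : Fin n), p = darkPoint n ℓ k) ∨
      ∃ (l : Fin n) (j : ℕ), j ≤ n ∧ p = site n (l + 1) j := by
  obtain ⟨x, y⟩ := p
  rw [mem_vertices] at hp
  dsimp only at hp
  rcases Int.even_or_odd' (x + y - (n - 1)) with ⟨t, ht | ht⟩
  · right
    refine ⟨⟨(x - t).toNat, by omega⟩, t.toNat, by omega, ?_⟩
    simp only [site, Prod.mk.injEq]
    push_cast
    omega
  · left
    refine ⟨⟨(x - t).toNat, by omega⟩, ⟨t.toNat, by omega⟩, ?_⟩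
    simp only [darkPoint, Prod.mk.injEq]
    omega

/-- The neighbours of a dark vertex are its four possible mates. -/
lemma adj_darkPoint_iff {n ℓ k : ℕ} {q : ℤ × ℤ} :
    |(darkPoint n ℓ k).1 - q.1| + |(darkPoint n ℓ k).2 - q.2| = 1 ↔
      ∃ s, q = matePoint n ℓ k s := by
  obtain ⟨x, y⟩ := q
  rw [abs_add_abs_eq_one]
  simp only [Prod.exists, Bool.exists_bool, matePoint, site, target, darkPoint, Prod.mk.injEq,
    Bool.not_true, Bool.not_false, Bool.toNat_true, Bool.toNat_false]
  push_cast
  omega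

lemma matePoint_injective {n ℓ k : ℕ} {s s' : Bool × Bool}
    (h : matePoint n ℓ k s = matePoint n ℓ k s') : s = s' := by
  obtain ⟨h1, h2⟩ := site_injective h
  simp only [target] at h2
  push_cast at h2
  rw [add_left_cancel_iff] at h1 h2
  obtain ⟨a, c⟩ := s
  obtain ⟨a', c'⟩ := s'
  cases a <;> cases a' <;> cases c <;> cases c' <;> simp at h1 h2 <;> rfl

lemma matePoint_eq_site_iff {n ℓ k : ℕ} {s : Bool × Bool} {l : ℕ} {j : ℤ} :
    matePoint n ℓ k s = site n (l + 1) j ↔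
      (((ℓ = l + 1 ∧ s.1 = true) ∨ (ℓ = l ∧ s.1 = false)) ∧ (target k s : ℤ) = j) := by
  constructor
  · intro h
    obtain ⟨h1, h2⟩ := site_injective h
    refine ⟨?_, h2⟩
    cases hs : s.1 <;> simp [hs] at h1 <;> simp [h1]
  · rintro ⟨⟨rfl, hs⟩ | ⟨rfl, hs⟩, rfl⟩ <;> simp [matePoint, hs]

/-! ### Configurations as coverings by columns -/

lemma coverCount_eq_card {N : ℕ} (e : Fin N → Bool × Bool) (s : Bool) (j : ℕ) :
    coverCount e s j = Finset.card {k : Fin N | (e k).1 = s ∧ target k (e k) = j} := by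
  rw [coverCount, Finset.card_filter]

lemma coverCount_eq_zero_iff {N : ℕ} {e : Fin N → Bool × Bool} {s : Bool} {j : ℕ} :
    coverCount e s j = 0 ↔ ∀ k, ¬ ((e k).1 = s ∧ target k (e k) = j) := by
  rw [coverCount_eq_card, Finset.card_eq_zero, Finset.filter_eq_empty_iff]
  simp

lemma coverCount_eq_one_iff {N : ℕ} {e : Fin N → Bool × Bool} {s : Bool} {j : ℕ} :
    coverCount e s j = 1 ↔ ∃! k, (e k).1 = s ∧ target k (e k) = j := by
  rw [coverCount_eq_card, Finset.card_eq_one]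
  constructor
  · rintro ⟨k, hk⟩
    have h : ∀ k', ((e k').1 = s ∧ target k' (e k') = j) ↔ k' = k := fun k' => by
      simpa using Finset.ext_iff.1 hk k'
    exact ⟨k, (h k).2 rfl, fun k' hk' => (h k').1 hk'⟩
  · rintro ⟨k, hk, hu⟩
    refine ⟨k, Finset.ext fun k' => ?_⟩
    simp only [Finset.mem_filter, Finset.mem_univ, true_and, Finset.mem_singleton]
    exact ⟨hu k', fun h => h ▸ hk⟩

/-- A choice of a direction for the dimer at every dark vertex which covers each site once. The
dimers of the outer columns have to point inwards. -/
def IsCovering {n : ℕ} (d : Fin (n + 1) → Fin n → Bool × Bool) : Prop :=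
  (∀ (l : Fin n) (j : ℕ), j ≤ n →
    coverCount (d l.succ) true j + coverCount (d l.castSucc) false j = 1) ∧
  (∀ k, (d 0 k).1 = false) ∧ ∀ k, (d (Fin.last n) k).1 = true

lemma isCovering_existsUnique {n : ℕ} {d : Fin (n + 1) → Fin n → Bool × Bool} (hd : IsCovering d)
    (l : Fin n) {j : ℕ} (hj : j ≤ n) :
    ∃! b : Fin (n + 1) × Fin n, matePoint n b.1 b.2 (d b.1 b.2) = site n (l + 1) j := by
  have hiff : ∀ b : Fin (n + 1) × Fin n, matePoint n b.1 b.2 (d b.1 b.2) = site n (l + 1) j ↔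
      ((b.1 = l.succ ∧ (d b.1 b.2).1 = true) ∨ (b.1 = l.castSucc ∧ (d b.1 b.2).1 = false)) ∧
        target b.2 (d b.1 b.2) = j := by
    intro b
    rw [matePoint_eq_site_iff, Nat.cast_inj, Fin.ext_iff, Fin.ext_iff, Fin.val_succ,
      Fin.val_castSucc]
  simp only [hiff]
  have h := hd.1 l j hj
  rcases Nat.add_eq_one_iff.1 h with ⟨h0, h1⟩ | ⟨h1, h0⟩
  · rw [coverCount_eq_zero_iff] at h0
    obtain ⟨k, hk, hu⟩ := coverCount_eq_one_iff.1 h1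
    refine ⟨(l.castSucc, k), ⟨Or.inr ⟨rfl, hk.1⟩, hk.2⟩, ?_⟩
    rintro ⟨ℓ, k'⟩ ⟨⟨hl, hs⟩ | ⟨hl, hs⟩, ht⟩
    · dsimp only at hl hs ht
      subst hl
      exact absurd ⟨hs, ht⟩ (h0 k')
    · dsimp only at hl hs ht
      subst hl
      rw [hu k' ⟨hs, ht⟩]
  · rw [coverCount_eq_zero_iff] at h0
    obtain ⟨k, hk, hu⟩ := coverCount_eq_one_iff.1 h1
    refine ⟨(l.succ, k), ⟨Or.inl ⟨rfl, hk.1⟩, hk.2⟩, ?_⟩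
    rintro ⟨ℓ, k'⟩ ⟨⟨hl, hs⟩ | ⟨hl, hs⟩, ht⟩
    · dsimp only at hl hs ht
      subst hl
      rw [hu k' ⟨hs, ht⟩]
    · dsimp only at hl hs ht
      subst hl
      exact absurd ⟨hs, ht⟩ (h0 k')

lemma isCovering_matePoint_mem {n : ℕ} {d : Fin (n + 1) → Fin n → Bool × Bool}
    (hd : IsCovering d) (ℓ : Fin (n + 1)) (k : Fin n) :
    matePoint n ℓ k (d ℓ k) ∈ vertices n := by
  have hk := k.2
  have hl := ℓ.2
  have hb := Bool.toNat_le (d ℓ k).2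
  rw [matePoint, site_mem_iff, target]
  refine ⟨?_, by push_cast; omega⟩
  cases hs : (d ℓ k).1
  · have : ℓ ≠ Fin.last n := by
      rintro rfl
      rw [hd.2.2] at hs
      exact absurd hs (by simp)
    have := Fin.val_lt_last this
    simp
    omega
  · have : ℓ ≠ 0 := by
      rintro rfl
      rw [hd.2.1] at hs
      exact absurd hs (by simp)
    have := Fin.pos_iff_ne_zero.2 this
    rw [Fin.lt_def, Fin.val_zero] at this
    simp
    omega

/-- The vertex at height `k` of column `ℓ`. -/
def darkVertex {n : ℕ} (ℓ : Fin (n + 1)) (k : Fin n) : vertices n :=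
  ⟨darkPoint n ℓ k, darkPoint_mem ℓ k⟩

lemma exists_direction {n : ℕ} (c : Config n) (ℓ : Fin (n + 1)) (k : Fin n) :
    ∃ s, ∃ q : vertices n, c.1.Adj (darkVertex ℓ k) q ∧ (q : ℤ × ℤ) = matePoint n ℓ k s := by
  obtain ⟨q, hq, -⟩ := c.2.1 (c.2.2 (darkVertex ℓ k))
  obtain ⟨s, hs⟩ := adj_darkPoint_iff.1 (c.1.adj_sub hq)
  exact ⟨s, q, hq, hs⟩

/-- The directions of the dimers of a configuration at the dark vertices. -/
def directions {n : ℕ} (c : Config n) (ℓ : Fin (n + 1)) (k : Fin n) : Bool × Bool :=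
  (exists_direction c ℓ k).choose

/-- The site matched to a dark vertex. -/
def mate {n : ℕ} (c : Config n) (ℓ : Fin (n + 1)) (k : Fin n) : vertices n :=
  (exists_direction c ℓ k).choose_spec.choose

lemma adj_mate {n : ℕ} (c : Config n) (ℓ : Fin (n + 1)) (k : Fin n) :
    c.1.Adj (darkVertex ℓ k) (mate c ℓ k) :=
  (exists_direction c ℓ k).choose_spec.choose_spec.1

lemma coe_mate {n : ℕ} (c : Config n) (ℓ : Fin (n + 1)) (k : Fin n) :
    (mate c ℓ k : ℤ × ℤ) = matePoint n ℓ k (directions c ℓ k) :=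
  (exists_direction c ℓ k).choose_spec.choose_spec.2

lemma config_adj_unique {n : ℕ} (c : Config n) {p q q' : vertices n} (h : c.1.Adj p q)
    (h' : c.1.Adj p q') : q = q' :=
  (c.2.1 (c.2.2 p)).unique h h'

lemma adj_darkVertex_iff {n : ℕ} (c : Config n) (ℓ : Fin (n + 1)) (k : Fin n) (q : vertices n) :
    c.1.Adj (darkVertex ℓ k) q ↔ (q : ℤ × ℤ) = matePoint n ℓ k (directions c ℓ k) := by
  constructor
  · intro h
    rw [config_adj_unique c h (adj_mate c ℓ k), coe_mate]
  · intro h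
    rw [← coe_mate] at h
    rw [Subtype.ext h]
    exact adj_mate c ℓ k

lemma not_adj_site_site {n : ℕ} (c : Config n) {p q : vertices n} {ℓ ℓ' : ℕ} {k k' : ℤ}
    (hp : (p : ℤ × ℤ) = site n ℓ k) (hq : (q : ℤ × ℤ) = site n ℓ' k') : ¬ c.1.Adj p q := by
  intro h
  have h := c.1.adj_sub h
  change |p.1.1 - q.1.1| + |p.1.2 - q.1.2| = 1 at h
  rw [abs_add_abs_eq_one, hp, hq] at h
  simp only [site] at h
  omega

/-- Adjacency in a configuration, in terms of directions. -/
lemma config_adj_iff {n : ℕ} (c : Config n) (p q : vertices n) :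
    c.1.Adj p q ↔ ∃ (ℓ : Fin (n + 1)) (k : Fin n),
      ((p : ℤ × ℤ) = darkPoint n ℓ k ∧ (q : ℤ × ℤ) = matePoint n ℓ k (directions c ℓ k)) ∨
      ((q : ℤ × ℤ) = darkPoint n ℓ k ∧ (p : ℤ × ℤ) = matePoint n ℓ k (directions c ℓ k)) := by
  constructor
  · intro h
    rcases exists_darkPoint_or_site p.2 with ⟨ℓ, k, hp⟩ | ⟨l, j, _, hp⟩
    · refine ⟨ℓ, k, Or.inl ⟨hp, ?_⟩⟩
      rw [← adj_darkVertex_iff]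
      rwa [show darkVertex ℓ k = p from Subtype.ext hp.symm]
    rcases exists_darkPoint_or_site q.2 with ⟨ℓ, k, hq⟩ | ⟨l', j', _, hq⟩
    · refine ⟨ℓ, k, Or.inr ⟨hq, ?_⟩⟩
      rw [← adj_darkVertex_iff]
      rw [show darkVertex ℓ k = q from Subtype.ext hq.symm]
      exact h.symm
    · exact absurd h (not_adj_site_site c hp hq)
  · rintro ⟨ℓ, k, ⟨hp, hq⟩ | ⟨hq, hp⟩⟩
    · rw [show p = darkVertex ℓ k from Subtype.ext hp, adj_darkVertex_iff, hq]
    · refine SimpleGraph.Subgraph.Adj.symm ?_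
      rw [show q = darkVertex ℓ k from Subtype.ext hq, adj_darkVertex_iff, hp]

lemma directions_injective {n : ℕ} :
    Function.Injective (directions : Config n → Fin (n + 1) → Fin n → Bool × Bool) := by
  intro c c' h
  refine Subtype.ext (SimpleGraph.Subgraph.ext ?_ ?_)
  · rw [SimpleGraph.Subgraph.isSpanning_iff.1 c.2.2, SimpleGraph.Subgraph.isSpanning_iff.1 c'.2.2]
  · ext p q
    rw [config_adj_iff, config_adj_iff, h]

lemma existsUnique_mate_eq_site {n : ℕ} (c : Config n) (l : Fin n) {j : ℕ} (hj : j ≤ n) :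
    ∃! b : Fin (n + 1) × Fin n,
      matePoint n b.1 b.2 (directions c b.1 b.2) = site n (l + 1) j := by
  set v : vertices n := ⟨site n (l + 1) j, site_mem (by omega) (by have := l.2; omega) hj⟩ with hv
  obtain ⟨q, hq, hu⟩ := c.2.1 (c.2.2 v)
  rcases exists_darkPoint_or_site q.2 with ⟨ℓ, k, hd⟩ | ⟨l', j', _, hs⟩
  · have hqd : q = darkVertex ℓ k := Subtype.ext hd
    refine ⟨(ℓ, k), ?_, ?_⟩
    · have := hq.symm
      rw [hqd, adj_darkVertex_iff] at this
      exact this.symm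
    · rintro ⟨ℓ', k'⟩ h'
      have : c.1.Adj (darkVertex ℓ' k') v := (adj_darkVertex_iff c ℓ' k' v).2 h'.symm
      have h2 := congrArg Subtype.val ((hu _ this.symm).trans hqd)
      obtain ⟨e1, e2⟩ := darkPoint_injective h2
      exact Prod.ext (Fin.ext e1) (Fin.ext e2)
  · exact absurd hq (not_adj_site_site c rfl hs)

lemma directions_isCovering {n : ℕ} (c : Config n) : IsCovering (directions c) := by
  refine ⟨fun l j hj => ?_, fun k => ?_, fun k => ?_⟩
  · obtain ⟨⟨ℓ, k⟩, hb, hu⟩ := existsUnique_mate_eq_site c l hj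
    dsimp only at hb
    have hu' : ∀ (ℓ' : Fin (n + 1)) (k' : Fin n),
        matePoint n ℓ' k' (directions c ℓ' k') = site n (l + 1) j → ℓ' = ℓ ∧ k' = k :=
      fun ℓ' k' h' => by simpa using hu (ℓ', k') h'
    have hne : l.castSucc ≠ l.succ := Fin.castSucc_lt_succ.ne
    have hS : ∀ k', (directions c l.succ k').1 = true ∧ target k' (directions c l.succ k') = j →
        matePoint n l.succ k' (directions c l.succ k') = site n (l + 1) j := fun k' h' =>
      matePoint_eq_site_iff.2 ⟨Or.inl ⟨Fin.val_succ l, h'.1⟩, by exact_mod_cast h'.2⟩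
    have hC : ∀ k', (directions c l.castSucc k').1 = false ∧
        target k' (directions c l.castSucc k') = j →
        matePoint n l.castSucc k' (directions c l.castSucc k') = site n (l + 1) j := fun k' h' =>
      matePoint_eq_site_iff.2 ⟨Or.inr ⟨Fin.val_castSucc l, h'.1⟩, by exact_mod_cast h'.2⟩
    rcases matePoint_eq_site_iff.1 hb with ⟨⟨hl, hs⟩ | ⟨hl, hs⟩, ht⟩
    · have hl : ℓ = l.succ := Fin.ext hl
      subst hl
      have h1 : coverCount (directions c l.succ) true j = 1 := coverCount_eq_one_iff.2
        ⟨k, ⟨hs, by exact_mod_cast ht⟩, fun k' h' => (hu' _ _ (hS k' h')).2⟩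
      have h0 : coverCount (directions c l.castSucc) false j = 0 := coverCount_eq_zero_iff.2
        fun k' h' => hne (hu' _ _ (hC k' h')).1
      rw [h1, h0]
    · have hl : ℓ = l.castSucc := Fin.ext hl
      subst hl
      have h1 : coverCount (directions c l.castSucc) false j = 1 := coverCount_eq_one_iff.2
        ⟨k, ⟨hs, by exact_mod_cast ht⟩, fun k' h' => (hu' _ _ (hC k' h')).2⟩
      have h0 : coverCount (directions c l.succ) true j = 0 := coverCount_eq_zero_iff.2
        fun k' h' => hne.symm (hu' _ _ (hS k' h')).1
      rw [h1, h0]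
  · by_contra h
    have := (mate c 0 k).2
    rw [coe_mate, matePoint, site_mem_iff] at this
    rw [Bool.not_eq_false] at h
    simp [h] at this
  · by_contra h
    have := (mate c (Fin.last n) k).2
    rw [coe_mate, matePoint, site_mem_iff] at this
    simp at this
    exact h this.1.2

/-- Every covering comes from a configuration. -/
lemma exists_config_of_isCovering {n : ℕ} {d : Fin (n + 1) → Fin n → Bool × Bool}
    (hd : IsCovering d) : ∃ c : Config n, directions c = d := by
  let M : (graph n).Subgraph :=
    { verts := Set.univ
      Adj := fun p q => ∃ (ℓ : Fin (n + 1)) (k : Fin n),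
        ((p : ℤ × ℤ) = darkPoint n ℓ k ∧ (q : ℤ × ℤ) = matePoint n ℓ k (d ℓ k)) ∨
        ((q : ℤ × ℤ) = darkPoint n ℓ k ∧ (p : ℤ × ℤ) = matePoint n ℓ k (d ℓ k))
      adj_sub := by
        rintro p q ⟨ℓ, k, ⟨hp, hq⟩ | ⟨hq, hp⟩⟩
        · change |p.1.1 - q.1.1| + |p.1.2 - q.1.2| = 1
          rw [hp]
          exact adj_darkPoint_iff.2 ⟨_, hq⟩
        · refine SimpleGraph.Adj.symm ?_
          change |q.1.1 - p.1.1| + |q.1.2 - p.1.2| = 1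
          rw [hq]
          exact adj_darkPoint_iff.2 ⟨_, hp⟩
      edge_vert := fun _ => Set.mem_univ _
      symm := ⟨fun p q ⟨ℓ, k, h⟩ => ⟨ℓ, k, h.symm⟩⟩ }
  have hM : M.IsPerfectMatching := by
    refine ⟨fun v _ => ?_, fun v => Set.mem_univ v⟩
    rcases exists_darkPoint_or_site v.2 with ⟨ℓ, k, hv⟩ | ⟨l, j, hj, hv⟩
    · refine ⟨⟨_, isCovering_matePoint_mem hd ℓ k⟩, ⟨ℓ, k, Or.inl ⟨hv, rfl⟩⟩, ?_⟩
      rintro q ⟨ℓ', k', ⟨hv', hq⟩ | ⟨_, hv'⟩⟩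
      · obtain ⟨e1, e2⟩ := darkPoint_injective (hv.symm.trans hv')
        rw [← Fin.ext e1, ← Fin.ext e2] at hq
        exact Subtype.ext hq
      · exact absurd (hv.symm.trans hv') darkPoint_ne_site
    · obtain ⟨⟨ℓ, k⟩, hb, hu⟩ := isCovering_existsUnique hd l hj
      refine ⟨darkVertex ℓ k, ⟨ℓ, k, Or.inr ⟨rfl, hv.trans hb.symm⟩⟩, ?_⟩
      rintro q ⟨ℓ', k', ⟨hv', _⟩ | ⟨hq, hv'⟩⟩
      · exact absurd (hv'.symm.trans hv) darkPoint_ne_site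
      · have := hu (ℓ', k') (hv'.symm.trans hv)
        simp only [Prod.mk.injEq] at this
        rw [this.1, this.2] at hq
        exact Subtype.ext hq
  refine ⟨⟨M, hM⟩, ?_⟩
  funext ℓ k
  have h : M.Adj (darkVertex ℓ k) ⟨_, isCovering_matePoint_mem hd ℓ k⟩ :=
    ⟨ℓ, k, Or.inl ⟨rfl, rfl⟩⟩
  exact (matePoint_injective ((adj_darkVertex_iff ⟨M, hM⟩ ℓ k _).1 h)).symm

open Classical in
/-- Sums over configurations are sums over coverings. -/
lemma sum_config_eq {n : ℕ} (P : (Fin (n + 1) → Fin n → Bool × Bool) → Prop)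
    (F : (Fin (n + 1) → Fin n → Bool × Bool) → ℝ) :
    ∑ c : Config n with P (directions c), F (directions c) =
      ∑ d with IsCovering d ∧ P d, F d := by
  refine Finset.sum_bij (fun c _ => directions c) ?_ ?_ ?_ ?_
  · intro c hc
    simp only [Finset.mem_filter, Finset.mem_univ, true_and] at hc ⊢
    exact ⟨directions_isCovering c, hc⟩
  · intro c _ c' _ h
    exact directions_injective h
  · intro d hd
    simp only [Finset.mem_filter, Finset.mem_univ, true_and] at hd
    obtain ⟨c, rfl⟩ := exists_config_of_isCovering hd.1
    exact ⟨c, by simpa using hd.2, rfl⟩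
  · intro c _
    rfl

/-! ### The particles of a configuration -/

lemma coverCount_le_one {n : ℕ} {d : Fin (n + 1) → Fin n → Bool × Bool} (hd : IsCovering d)
    (l : Fin n) {j : ℕ} (hj : j ≤ n) : coverCount (d l.succ) true j ≤ 1 := by
  have := hd.1 l j hj
  omega

lemma coverCount_ne_zero_imp_le {N : ℕ} {e : Fin N → Bool × Bool} {s : Bool} {j : ℕ}
    (h : coverCount e s j ≠ 0) : j ≤ N := by
  rw [Ne, coverCount_eq_zero_iff] at h
  push Not at h
  obtain ⟨k, -, rfl⟩ := h
  have := k.2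
  have := Bool.toNat_le (e k).2
  rw [target]
  omega

/-- The particles on a level are the sites covered from the right. -/
lemma mem_particles_iff {n : ℕ} (c : Config n) (l : Fin n) (z : ℤ) :
    z ∈ particles c (l + 1) ↔
      ∃ j : ℕ, z = j ∧ coverCount (directions c l.succ) true j ≠ 0 := by
  have hl := l.2
  rw [particles, Set.mem_ofPred_eq]
  constructor
  · rintro (⟨h, -⟩ | ⟨-, -, p, q, hpq, hp, hq⟩)
    · omega
    · obtain ⟨ℓ, k, ⟨hp', -⟩ | ⟨hq', hp'⟩⟩ := (config_adj_iff c p q).1 hpq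
      · exact absurd (hp'.symm.trans hp) darkPoint_ne_site
      · rw [hq', darkPoint] at hq
        obtain ⟨hs, ht⟩ := matePoint_eq_site_iff.1 (hp'.symm.trans hp)
        have hne : (ℓ : ℕ) ≠ l := by
          intro hne
          rw [hne, site] at hq
          simp only [Prod.mk.injEq, Prod.mk_add_mk] at hq
          push_cast at hq
          omega
        rcases hs with ⟨hℓ, hs⟩ | ⟨hℓ, -⟩
        · have hℓ : ℓ = l.succ := Fin.ext hℓ
          subst hℓ
          refine ⟨_, ht.symm, ?_⟩
          rw [Ne, coverCount_eq_zero_iff]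
          exact fun h => h k ⟨hs, rfl⟩
        · exact absurd hℓ hne
  · rintro ⟨j, rfl, hj⟩
    right
    rw [Ne, coverCount_eq_zero_iff] at hj
    push Not at hj
    obtain ⟨k, hs, ht⟩ := hj
    have hm : matePoint n l.succ k (directions c l.succ k) = site n (l + 1) j :=
      matePoint_eq_site_iff.2 ⟨Or.inl ⟨Fin.val_succ l, hs⟩, by exact_mod_cast ht⟩
    refine ⟨by omega, by omega, mate c l.succ k, darkVertex l.succ k, (adj_mate c _ _).symm,
      (coe_mate c _ _).trans hm, ?_⟩
    simp only [darkVertex, darkPoint, site, Prod.mk.injEq, Prod.mk_add_mk, ← ht, target,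
      Fin.val_succ]
    push_cast
    cases (directions c l.succ k).2
    · left; simp; omega
    · right; simp; omega

lemma sum_coverCount {N : ℕ} (e : Fin N → Bool × Bool) (s : Bool) :
    ∑ j ∈ Finset.range (N + 1), coverCount e s j = Finset.card {k : Fin N | (e k).1 = s} := by
  simp only [coverCount_eq_card]
  rw [Finset.card_eq_sum_card_fiberwise (f := fun k : Fin N => target k (e k))
    (t := Finset.range (N + 1))]
  · simp only [Finset.filter_filter]
  · intro k _
    have := k.2
    have := Bool.toNat_le (e k).2
    simp only [Finset.coe_range, Set.mem_Iio, target]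
    omega

/-- In column `ℓ` of a covering, exactly `ℓ` dimers go to the left. -/
lemma card_left_eq {n : ℕ} {d : Fin (n + 1) → Fin n → Bool × Bool} (hd : IsCovering d)
    (ℓ : Fin (n + 1)) : Finset.card {k : Fin n | (d ℓ k).1 = true} = ℓ := by
  induction ℓ using Fin.induction with
  | zero =>
    rw [Fin.val_zero, Finset.card_eq_zero, Finset.filter_eq_empty_iff]
    intro k _
    simp [hd.2.1 k]
  | succ l ih =>
    have h : ∑ j ∈ Finset.range (n + 1),
        (coverCount (d l.succ) true j + coverCount (d l.castSucc) false j) = n + 1 := by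
      rw [Finset.sum_congr rfl fun j hj => hd.1 l j (by rw [Finset.mem_range] at hj; omega)]
      simp
    rw [Finset.sum_add_distrib, sum_coverCount, sum_coverCount] at h
    have h2 := Finset.card_filter_add_card_filter_not (s := (Finset.univ : Finset (Fin n)))
      (fun k => (d l.castSucc k).1 = true)
    simp only [Bool.not_eq_true, Finset.card_univ, Fintype.card_fin] at h2
    rw [ih, Fin.val_castSucc] at h2
    rw [Fin.val_succ]
    omega

lemma existsUnique_strictMono_range {n k : ℕ} (s : Finset ℤ) (hk : s.card = k)
    (hs : ∀ t ∈ s, 0 ≤ t ∧ t ≤ (n : ℤ)) :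
    ∃! z, z ∈ heightTuples n k ∧ Set.range z = (s : Set ℤ) := by
  refine ⟨s.orderEmbOfFin hk, ⟨mem_heightTuples.2 ⟨fun i => hs _ (s.orderEmbOfFin_mem hk i),
    (s.orderEmbOfFin hk).strictMono⟩, s.range_orderEmbOfFin hk⟩, ?_⟩
  rintro z ⟨hz, hr⟩
  refine ((mem_heightTuples.1 hz).2.range_inj (s.orderEmbOfFin hk).strictMono).1 ?_
  rw [hr, s.range_orderEmbOfFin hk]

lemma particles_last {n : ℕ} (c : Config n) :
    particles c (n + 1) = ((Finset.Icc 0 (n : ℤ) : Finset ℤ) : Set ℤ) := by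
  ext z
  rw [particles, Set.mem_ofPred_eq]
  simp

/-- There are `k` particles on level `k`, so they are listed by exactly one increasing tuple. -/
lemma existsUnique_particles {n : ℕ} (c : Config n) {k : ℕ} (h1 : 1 ≤ k) (hk : k ≤ n + 1) :
    ∃! z, z ∈ heightTuples n k ∧ Set.range z = particles c k := by
  rcases hk.eq_or_lt with rfl | hk
  · rw [particles_last]
    exact existsUnique_strictMono_range _ (by simp) fun t ht => Finset.mem_Icc.1 ht
  · obtain ⟨l, rfl⟩ : ∃ l : Fin n, k = l + 1 := ⟨⟨k - 1, by omega⟩, by simp; omega⟩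
    set s : Finset ℕ :=
      {j ∈ Finset.range (n + 1) | coverCount (directions c l.succ) true j ≠ 0} with hs
    have hp : particles c (l + 1) = ((s.image fun j : ℕ => (j : ℤ) : Finset ℤ) : Set ℤ) := by
      ext z
      rw [mem_particles_iff]
      simp only [hs, Finset.coe_image, Finset.coe_filter, Finset.mem_range, Set.mem_image,
        Set.mem_ofPred_eq]
      constructor
      · rintro ⟨j, rfl, hj⟩
        exact ⟨j, ⟨Nat.lt_succ_of_le (coverCount_ne_zero_imp_le hj), hj⟩, rfl⟩
      · rintro ⟨j, ⟨-, hj⟩, rfl⟩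
        exact ⟨j, rfl, hj⟩
    rw [hp]
    refine existsUnique_strictMono_range _ ?_ ?_
    · rw [Finset.card_image_of_injective _ Nat.cast_injective, hs, Finset.card_filter]
      have hd := directions_isCovering c
      rw [← Fin.val_succ l, ← card_left_eq hd l.succ, ← sum_coverCount]
      refine Finset.sum_congr rfl fun j hj => ?_
      have := coverCount_le_one hd l (j := j) (by rw [Finset.mem_range] at hj; omega)
      split_ifs with h <;> omega
    · intro t ht
      simp only [hs, Finset.mem_image, Finset.mem_filter, Finset.mem_range] at ht
      obtain ⟨j, hj, rfl⟩ := ht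
      omega

/-! ### The weight of a configuration -/

/-- The weight of the face whose least corner is `site n ℓ k`, with `t = ℓ + k`. -/
def stepWeight (a b : ℝ) (t : ℕ) : ℝ := if Even t then b else a

lemma stepWeight_pos {a b : ℝ} (ha : 0 < a) (hb : 0 < b) (t : ℕ) : 0 < stepWeight a b t := by
  unfold stepWeight
  split_ifs <;> assumption

lemma faceWeight_site (a b : ℝ) (n l k : ℕ) :
    faceWeight a b n (site n (l + 1) k) = stepWeight a b (l + 1 + k) := by
  have h1 : Even ((site n (l + 1) k).1 + (site n (l + 1) k).2 - ((n : ℤ) - 1)) := by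
    refine ⟨k, ?_⟩
    simp only [site]
    push_cast
    ring
  have h2 : Even (site n (l + 1) k).1 ↔ ¬ Even (l + 1 + k) := by
    simp only [site]
    rw [← Int.even_coe_nat (l + 1 + k)]
    push_cast
    rw [Int.even_iff, Int.even_iff]
    omega
  rw [faceWeight, if_pos h1, stepWeight]
  by_cases h : Even (l + 1 + k)
  · rw [if_pos h, if_neg (by rw [h2]; exact not_not.2 h)]
  · rw [if_neg h, if_pos (h2.2 h)]

/-- The weighted face adjacent to a dimer at a dark vertex. -/
def dimerFace (n ℓ k : ℕ) (s : Bool × Bool) : ℤ × ℤ := site n (ℓ + (!s.1).toNat) k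

lemma dimerFace_mem_faces {n : ℕ} {d : Fin (n + 1) → Fin n → Bool × Bool} (hd : IsCovering d)
    (ℓ : Fin (n + 1)) (k : Fin n) : dimerFace n ℓ k (d ℓ k) ∈ faces n := by
  have hm := isCovering_matePoint_mem hd ℓ k
  have hk := k.2
  rw [matePoint, site_mem_iff] at hm
  rw [dimerFace]
  generalize (ℓ : ℕ) + (!(d ℓ k).1).toNat = l at *
  obtain ⟨hl, -⟩ := hm
  simp only [faces, corners, Finset.mem_filter, Finset.insert_subset_iff,
    Finset.singleton_subset_iff, mem_vertices, site]
  omega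

/-- A dimer lies along a face of the weighted parity class only if it is the face `dimerFace`. -/
lemma dimer_subset_corners_iff {n ℓ k : ℕ} {s : Bool × Bool} {f : ℤ × ℤ}
    (hf : Even (f.1 + f.2 - ((n : ℤ) - 1))) :
    (darkPoint n ℓ k ∈ corners f ∧ matePoint n ℓ k s ∈ corners f) ↔ dimerFace n ℓ k s = f := by
  obtain ⟨x, y⟩ := f
  obtain ⟨t, ht⟩ := hf
  obtain ⟨s₁, s₂⟩ := s
  simp only [corners, Finset.mem_insert, Finset.mem_singleton, darkPoint, matePoint, dimerFace,
    site, target, Prod.mk.injEq] at *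
  cases s₁ <;> cases s₂ <;> simp only [Bool.not_true, Bool.not_false, Bool.toNat_true,
    Bool.toNat_false] <;> push_cast <;> omega

lemma dimersAround_eq {n : ℕ} (c : Config n) {f : ℤ × ℤ}
    (hf : Even (f.1 + f.2 - ((n : ℤ) - 1))) :
    dimersAround c f = Finset.card {b : Fin (n + 1) × Fin n |
      dimerFace n b.1 b.2 (directions c b.1 b.2) = f} := by
  rw [dimersAround, ← Set.ncard_coe_finset]
  set φ : Fin (n + 1) × Fin n → Sym2 (vertices n) :=
    fun b => s(darkVertex b.1 b.2, mate c b.1 b.2) with hφ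
  have hinj : Function.Injective φ := by
    rintro ⟨ℓ, k⟩ ⟨ℓ', k'⟩ h
    simp only [hφ, Sym2.eq_iff] at h
    rcases h with ⟨h, -⟩ | ⟨h, -⟩
    · obtain ⟨e1, e2⟩ := darkPoint_injective (congrArg Subtype.val h)
      exact Prod.ext (Fin.ext e1) (Fin.ext e2)
    · have := congrArg Subtype.val h
      rw [coe_mate] at this
      exact absurd this darkPoint_ne_site
  rw [← Set.ncard_image_of_injective _ hinj]
  congr 1
  ext e
  simp only [Set.mem_ofPred_eq, Set.mem_image, Finset.coe_filter, Finset.mem_univ, true_and]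
  constructor
  · rintro ⟨he, hc⟩
    induction e using Sym2.ind with
    | _ p q =>
      rw [SimpleGraph.Subgraph.mem_edgeSet] at he
      simp only [Sym2.mem_iff, forall_eq_or_imp, forall_eq] at hc
      obtain ⟨ℓ, k, ⟨hp, hq⟩ | ⟨hq, hp⟩⟩ := (config_adj_iff c p q).1 he
      · refine ⟨(ℓ, k), ?_, ?_⟩
        · rw [← dimer_subset_corners_iff hf, ← hp, ← hq]
          exact hc
        · rw [← coe_mate] at hq
          rw [hφ, Sym2.eq_iff]
          exact Or.inl ⟨Subtype.ext hp.symm, Subtype.ext hq.symm⟩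
      · refine ⟨(ℓ, k), ?_, ?_⟩
        · rw [← dimer_subset_corners_iff hf, ← hp, ← hq]
          exact hc.symm
        · rw [← coe_mate] at hp
          rw [hφ, Sym2.eq_iff]
          exact Or.inr ⟨Subtype.ext hq.symm, Subtype.ext hp.symm⟩
  · rintro ⟨⟨ℓ, k⟩, hb, rfl⟩
    rw [← dimer_subset_corners_iff hf, ← coe_mate] at hb
    refine ⟨adj_mate c ℓ k, ?_⟩
    simp only [hφ, Sym2.mem_iff, forall_eq_or_imp, forall_eq]
    exact hb

lemma weight_eq_prod {n : ℕ} (a b : ℝ) (c : Config n) :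
    weight a b c = ∏ ℓ : Fin (n + 1), ∏ k : Fin n,
      stepWeight a b (ℓ + (!(directions c ℓ k).1).toNat + k) := by
  have hd := directions_isCovering c
  have h1 : ∀ f, faceWeight a b n f ^ dimersAround c f =
      ∏ b' : Fin (n + 1) × Fin n with
        dimerFace n b'.1 b'.2 (directions c b'.1 b'.2) = f, faceWeight a b n f := by
    intro f
    by_cases hf : Even (f.1 + f.2 - ((n : ℤ) - 1))
    · rw [dimersAround_eq c hf, Finset.prod_const]
    · rw [faceWeight, if_neg hf, one_pow, Finset.prod_const_one]
  rw [weight, Finset.prod_congr rfl fun f _ => h1 f,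
    Finset.prod_fiberwise_of_maps_to' (fun b' _ => dimerFace_mem_faces hd b'.1 b'.2),
    ← Finset.univ_product_univ, Finset.prod_product]
  refine Finset.prod_congr rfl fun ℓ _ => Finset.prod_congr rfl fun k _ => ?_
  have hm := isCovering_matePoint_mem hd ℓ k
  rw [matePoint, site_mem_iff] at hm
  rw [dimerFace]
  obtain ⟨l, hl⟩ : ∃ l, (ℓ : ℕ) + (!(directions c ℓ k).1).toNat = l + 1 :=
    ⟨_, (Nat.sub_add_cancel hm.1.1).symm⟩
  rw [hl, faceWeight_site]

lemma edgeProb_vParam_mul {a b : ℝ} (ha : 0 < a) (hb : 0 < b) (t : ℕ) :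
    stepWeight a b t =
      stepWeight a b (t + 1) * ((a ^ 2 + b ^ 2) / (a * b)) * edgeProb (vParam a b) t := by
  have hab : a ^ 2 + b ^ 2 ≠ 0 := by positivity
  unfold stepWeight edgeProb vParam
  by_cases h : Even t
  · have h' : ¬ Even (t + 1) := by rw [Nat.even_add_one]; simpa using h
    rw [if_pos h, if_neg h', if_pos ((Int.even_coe_nat t).2 h)]
    field_simp
    ring
  · have h' : Even (t + 1) := by rw [Nat.even_add_one]; simpa using h
    rw [if_neg h, if_pos h', if_neg (mt (Int.even_coe_nat t).1 h)]
    field_simp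
    ring

/-- The part of the weight of a configuration that does not depend on the configuration. -/
def weightConst (a b : ℝ) (n : ℕ) : ℝ :=
  ∏ ℓ : Fin (n + 1),
    ((∏ k : Fin n, stepWeight a b (ℓ + k + 1)) * ((a ^ 2 + b ^ 2) / (a * b)) ^ (ℓ : ℕ))

lemma weightConst_pos {a b : ℝ} (ha : 0 < a) (hb : 0 < b) (n : ℕ) : 0 < weightConst a b n := by
  refine Finset.prod_pos fun ℓ _ => mul_pos (Finset.prod_pos fun k _ => stepWeight_pos ha hb _) ?_
  positivity

/-- The weight, rewritten with weights on the dimers that go to the left only. -/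
lemma weight_eq_weightConst_mul {a b : ℝ} (ha : 0 < a) (hb : 0 < b) {n : ℕ} (c : Config n) :
    weight a b c = weightConst a b n * ∏ ℓ : Fin (n + 1), ∏ k : Fin n,
      if (directions c ℓ k).1 then edgeProb (vParam a b) (ℓ + k) else 1 := by
  rw [weight_eq_prod, weightConst, ← Finset.prod_mul_distrib]
  refine Finset.prod_congr rfl fun ℓ _ => ?_
  set τ := (a ^ 2 + b ^ 2) / (a * b) with hτ
  have hleft : τ ^ (ℓ : ℕ) = ∏ k : Fin n, if (directions c ℓ k).1 = true then τ else 1 := by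
    rw [← Finset.prod_filter, Finset.prod_const, card_left_eq (directions_isCovering c)]
  rw [hleft, ← Finset.prod_mul_distrib, ← Finset.prod_mul_distrib]
  refine Finset.prod_congr rfl fun k _ => ?_
  cases h : (directions c ℓ k).1
  · simp [add_right_comm]
  · have := edgeProb_vParam_mul ha hb (ℓ + k)
    rw [← hτ] at this
    push_cast at this
    simpa using this

/-! ### The density of all levels -/

lemma range_eq_of_mem_heightTuples {n : ℕ} {z : Fin (n + 1) → ℤ} (hz : z ∈ heightTuples n (n + 1)) :
    Set.range z = ((Finset.Icc 0 (n : ℤ) : Finset ℤ) : Set ℤ) := by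
  obtain ⟨hb, hs⟩ := mem_heightTuples.1 hz
  have : Finset.univ.image z = Finset.Icc 0 (n : ℤ) := by
    apply Finset.eq_of_subset_of_card_le
    · intro t ht
      obtain ⟨i, -, rfl⟩ := Finset.mem_image.1 ht
      exact Finset.mem_Icc.2 (hb i)
    · rw [Finset.card_image_of_injective _ hs.injective]
      simp
  rw [← this, Finset.coe_image, Finset.coe_univ, Set.image_univ]

lemma natCast_mem_heightTuples {n k : ℕ} (hk : k ≤ n + 1) :
    (fun i : Fin k => ((i : ℕ) : ℤ)) ∈ heightTuples n k := by
  refine mem_heightTuples.2 ⟨fun i => ?_, fun i j h => ?_⟩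
  · have := i.2
    omega
  · simpa using h

lemma eq_natCast_of_mem_heightTuples {n : ℕ} {z : Fin (n + 1) → ℤ}
    (hz : z ∈ heightTuples n (n + 1)) : z = fun i : Fin (n + 1) => ((i : ℕ) : ℤ) := by
  have h' := natCast_mem_heightTuples (n := n) (k := n + 1) le_rfl
  refine ((mem_heightTuples.1 hz).2.range_inj (mem_heightTuples.1 h').2).1 ?_
  rw [range_eq_of_mem_heightTuples hz, range_eq_of_mem_heightTuples h']

lemma interlaced_iff {n m : ℕ} {x : Positions} : Interlaced n m x ↔
    (∀ ℓ, 1 ≤ ℓ → ℓ ≤ m → x ℓ ∈ heightTuples n ℓ) ∧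
      ∀ ℓ, 1 ≤ ℓ → ℓ < m → Interlaces (x ℓ) (x (ℓ + 1)) := by
  simp only [Interlaced, mem_heightTuples, Interlaces]

lemma mem_heightTuples_of_produces {n m : ℕ} (hm : m ≤ n + 1) {c : Config n} {x : Positions}
    (h : Produces c m x) : ∀ ℓ, 1 ≤ ℓ → ℓ ≤ m → x ℓ ∈ heightTuples n ℓ := by
  intro ℓ h1 h2
  obtain ⟨hs, hr⟩ := h ℓ h1 h2
  obtain ⟨z, ⟨hz, hzr⟩, -⟩ := existsUnique_particles c h1 (h2.trans hm)
  rwa [(hs.range_inj (mem_heightTuples.1 hz).2).1 (hr.trans hzr.symm)]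

/-- The covering conditions of all columns, for prescribed particles on all levels. -/
def CoversColumns {n : ℕ} (x : Positions) (d : Fin (n + 1) → Fin n → Bool × Bool) : Prop :=
  ∀ ℓ : Fin (n + 1), ColumnCover (occupied (x ℓ)) (occupied (x (ℓ + 1))) 0 0 (d ℓ)

lemma occupied_zero (x : Fin 0 → ℤ) (j : ℕ) : occupied x j = false := by
  rw [← Bool.not_eq_true, occupied_eq_true]
  rintro ⟨i, -⟩
  exact i.elim0

lemma occupied_full {n : ℕ} {z : Fin (n + 1) → ℤ} (hz : z ∈ heightTuples n (n + 1)) {j : ℕ}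
    (hj : j ≤ n) : occupied z j = true := by
  rw [occupied_eq_true]
  have : (j : ℤ) ∈ Set.range z := by
    rw [range_eq_of_mem_heightTuples hz]
    simpa using hj
  exact this

lemma columnCover_iff {N : ℕ} {X Y : ℕ → Bool} {e : Fin N → Bool × Bool} :
    ColumnCover X Y 0 0 e ↔ ∀ j ≤ N, coverCount e true j = (X j).toNat ∧
      coverCount e false j = (!Y j).toNat := by
  simp [ColumnCover]

lemma isCovering_of_coversColumns {n : ℕ} {x : Positions}
    {d : Fin (n + 1) → Fin n → Bool × Bool} (hx : x (n + 1) ∈ heightTuples n (n + 1))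
    (h : CoversColumns x d) : IsCovering d := by
  have hk : ∀ (k : Fin n) (s : Bool × Bool), target k s ≤ n := by
    intro k s
    have := k.2
    have := Bool.toNat_le s.2
    rw [target]
    omega
  refine ⟨fun l j hj => ?_, fun k => ?_, fun k => ?_⟩
  · have h1 := (columnCover_iff.1 (h l.succ) j hj).1
    have h2 := (columnCover_iff.1 (h l.castSucc) j hj).2
    rw [h1, h2]
    change (occupied (x (l + 1)) j).toNat + (!occupied (x (l + 1)) j).toNat = 1
    cases occupied (x (l + 1)) j <;> rfl
  · by_contra hc
    rw [Bool.not_eq_false] at hc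
    have h1 := (columnCover_iff.1 (h 0) _ (hk k (d 0 k))).1
    rw [Fin.val_zero, occupied_zero, Bool.toNat_false, coverCount_eq_zero_iff] at h1
    exact h1 k ⟨hc, rfl⟩
  · by_contra hc
    rw [Bool.not_eq_true] at hc
    have h1 := (columnCover_iff.1 (h (Fin.last n)) _ (hk k (d (Fin.last n) k))).2
    have hv : ((Fin.last n : Fin (n + 1)) : ℕ) = n := rfl
    rw [hv, occupied_full hx (hk _ _), Bool.not_true, Bool.toNat_false,
      coverCount_eq_zero_iff] at h1
    exact h1 k ⟨hc, rfl⟩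

lemma produces_iff_coversColumns {n : ℕ} {x : Positions}
    (hx : ∀ ℓ, 1 ≤ ℓ → ℓ ≤ n + 1 → x ℓ ∈ heightTuples n ℓ) (c : Config n) :
    Produces c (n + 1) x ↔ CoversColumns x (directions c) := by
  have hlast := hx (n + 1) (by omega) le_rfl
  constructor
  · intro h
    have hd := directions_isCovering c
    have hocc : ∀ (l : Fin n) (j : ℕ), j ≤ n →
        coverCount (directions c l.succ) true j = (occupied (x (l + 1)) j).toNat := by
      intro l j hj
      have h1 := coverCount_le_one hd l hj
      have h2 : occupied (x (l + 1)) j = true ↔ coverCount (directions c l.succ) true j ≠ 0 := by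
        have h3 : (j : ℤ) ∈ Set.range (x (l + 1)) ↔ (j : ℤ) ∈ particles c (l + 1) := by
          rw [(h (l + 1) (by omega) (by omega)).2]
        rw [occupied_eq_true]
        refine h3.trans ((mem_particles_iff c l j).trans ⟨?_, fun h => ⟨j, rfl, h⟩⟩)
        rintro ⟨j', hj', h⟩
        rwa [Nat.cast_inj.1 hj']
      cases ho : occupied (x (l + 1)) j
      · rw [ho] at h2
        simpa using h2
      · have := h2.1 ho
        simp
        omega
    intro ℓ
    rw [columnCover_iff]
    intro j hj
    constructor
    · cases ℓ using Fin.cases with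
      | zero =>
        rw [Fin.val_zero, occupied_zero, Bool.toNat_false, coverCount_eq_zero_iff]
        intro k hk
        rw [hd.2.1 k] at hk
        exact absurd hk.1 (by simp)
      | succ l => exact hocc l j hj
    · cases ℓ using Fin.lastCases with
      | last =>
        have hv : ((Fin.last n : Fin (n + 1)) : ℕ) = n := rfl
        rw [hv, occupied_full hlast hj, Bool.not_true, Bool.toNat_false, coverCount_eq_zero_iff]
        intro k hk
        rw [hd.2.2 k] at hk
        exact absurd hk.1 (by simp)
      | cast l =>
        have h1 := hd.1 l j hj
        rw [hocc l j hj] at h1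
        change _ = (!occupied (x (l + 1)) j).toNat
        cases ho : occupied (x (l + 1)) j <;> rw [ho] at h1 <;> simp at h1 ⊢ <;> exact h1
  · intro h ℓ h1 h2
    refine ⟨(mem_heightTuples.1 (hx ℓ h1 h2)).2, ?_⟩
    rcases h2.eq_or_lt with rfl | h2'
    · rw [particles_last, range_eq_of_mem_heightTuples hlast]
    · obtain ⟨l, rfl⟩ : ∃ l : Fin n, ℓ = l + 1 := ⟨⟨ℓ - 1, by omega⟩, by simp; omega⟩
      ext z
      rw [mem_particles_iff]
      constructor
      · rintro ⟨i, rfl⟩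
        have hb := (mem_heightTuples.1 (hx _ h1 h2)).1 i
        have e : x (l + 1) i = ((x (l + 1) i).toNat : ℕ) := by omega
        refine ⟨(x (l + 1) i).toNat, e, ?_⟩
        rw [(columnCover_iff.1 (h l.succ) _ (by omega)).1]
        have : occupied (x (l.succ : Fin (n + 1))) (x (l + 1) i).toNat = true :=
          occupied_eq_true.2 ⟨i, e⟩
        rw [this]
        simp
      · rintro ⟨j, rfl, hj⟩
        rw [(columnCover_iff.1 (h l.succ) _ (coverCount_ne_zero_imp_le hj)).1] at hj
        have : occupied (x (l.succ : Fin (n + 1))) j = true := by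
          by_contra hc
          rw [Bool.not_eq_true] at hc
          rw [hc] at hj
          exact hj rfl
        exact occupied_eq_true.1 this

lemma pow_total (t : ℝ) (k : ℕ) (g : (ℓ : ℕ) → Fin ℓ → ℕ) :
    t ^ total k g = ∏ ℓ ∈ Finset.Icc 1 k, ∏ i : Fin ℓ, t ^ g ℓ i := by
  simp only [total, Finset.prod_pow_eq_pow_sum]

lemma Omega_eq_prod {a b : ℝ} (hab : a ^ 2 + b ^ 2 ≠ 0) (k : ℕ) (x : Positions) :
    Omega a b k x = ∏ ℓ ∈ Finset.Icc 1 k,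
      levelWeight (fun t => edgeProb (vParam a b) (ℓ + t)) (x ℓ) (x (ℓ + 1)) := by
  simp only [Omega, pow_add, pow_total, ← Finset.prod_mul_distrib, ← Finset.prod_div_distrib,
    levelWeight]
  refine Finset.prod_congr rfl fun ℓ _ => Finset.prod_congr rfl fun i _ => ?_
  simp only [alphaInf, alphaSup, evenInd, oddInd, edgeProb, vParam, eq_comm (a := x (ℓ + 1) _),
    ← Int.not_even_iff_odd]
  split_ifs <;> simp <;> field_simp <;> ring

open Classical in
/-- The total weight of the configurations with prescribed particles on all levels factorises over
the columns. -/
lemma sum_produces_eq {a b : ℝ} (hab : a ^ 2 + b ^ 2 ≠ 0) (n : ℕ) (x : Positions) :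
    ∑ c : Config n with Produces c (n + 1) x, ∏ ℓ : Fin (n + 1), ∏ k : Fin n,
      (if (directions c ℓ k).1 then edgeProb (vParam a b) (ℓ + k) else 1) =
    Omega a b n x * chi n (n + 1) x := by
  by_cases hx : ∀ ℓ, 1 ≤ ℓ → ℓ ≤ n + 1 → x ℓ ∈ heightTuples n ℓ
  · have hx' : ∀ ℓ ≤ n + 1, x ℓ ∈ heightTuples n ℓ := by
      intro ℓ hℓ
      rcases Nat.eq_zero_or_pos ℓ with rfl | h
      · exact mem_heightTuples.2 ⟨fun i => i.elim0, fun i => i.elim0⟩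
      · exact hx ℓ h hℓ
    simp only [produces_iff_coversColumns hx]
    rw [sum_config_eq (CoversColumns x) (fun d => ∏ ℓ : Fin (n + 1), ∏ k : Fin n,
      (if (d ℓ k).1 then edgeProb (vParam a b) (ℓ + k) else 1))]
    have hset : (Finset.univ.filter fun d : Fin (n + 1) → Fin n → Bool × Bool =>
        IsCovering d ∧ CoversColumns x d) = Fintype.piFinset fun ℓ : Fin (n + 1) =>
        Finset.univ.filter fun e : Fin n → Bool × Bool =>
          ColumnCover (occupied (x ℓ)) (occupied (x (ℓ + 1))) 0 0 e := by
      ext d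
      simp only [Finset.mem_filter, Finset.mem_univ, true_and, Fintype.mem_piFinset]
      exact ⟨fun h => h.2, fun h =>
        ⟨isCovering_of_coversColumns (hx (n + 1) (by omega) le_rfl) h, h⟩⟩
    rw [hset, ← Finset.prod_univ_sum (fun ℓ : Fin (n + 1) =>
      Finset.univ.filter fun e : Fin n → Bool × Bool =>
        ColumnCover (occupied (x ℓ)) (occupied (x (ℓ + 1))) 0 0 e)
      (fun ℓ e => ∏ k : Fin n, if (e k).1 then edgeProb (vParam a b) (ℓ + k) else 1)]
    have hcol : ∀ ℓ : Fin (n + 1), (∑ e : Fin n → Bool × Bool with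
        ColumnCover (occupied (x ℓ)) (occupied (x (ℓ + 1))) 0 0 e,
        ∏ k : Fin n, if (e k).1 then edgeProb (vParam a b) (ℓ + k) else 1) =
        if Interlaces (x ℓ) (x (ℓ + 1)) then
          levelWeight (fun t => edgeProb (vParam a b) (ℓ + t)) (x ℓ) (x (ℓ + 1)) else 0 := by
      intro ℓ
      have hl := ℓ.2
      rw [← columnSum_occupied (hx' _ (by omega)) (hx' _ (by omega))
        (p := fun t => edgeProb (vParam a b) (ℓ + t))]
      · rfl
      · intro t
        rw [← add_assoc, edgeProb_add_one]
    rw [Finset.prod_congr rfl fun ℓ _ => hcol ℓ,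
      Fin.prod_univ_eq_prod_range (fun ℓ => if Interlaces (x ℓ) (x (ℓ + 1)) then
          levelWeight (fun t => edgeProb (vParam a b) (ℓ + t)) (x ℓ) (x (ℓ + 1)) else 0) (n + 1),
      Finset.range_eq_Ico, Finset.prod_eq_prod_Ico_succ_bot (by omega),
      show Finset.Ico (0 + 1) (n + 1) = Finset.Icc 1 n by ext; simp,
      if_pos (show Interlaces (x 0) (x (0 + 1)) from fun i => i.elim0), Finset.prod_ite_zero, Omega_eq_prod hab, chi]
    have hint : Interlaced n (n + 1) x ↔
        ∀ ℓ ∈ Finset.Icc 1 n, Interlaces (x ℓ) (x (ℓ + 1)) := by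
      rw [interlaced_iff]
      constructor
      · intro h ℓ hℓ
        rw [Finset.mem_Icc] at hℓ
        exact h.2 ℓ hℓ.1 (by omega)
      · exact fun h => ⟨hx, fun ℓ h1 h2 => h ℓ (Finset.mem_Icc.2 ⟨h1, by omega⟩)⟩
    simp only [hint]
    simp [levelWeight]
  · rw [chi, if_neg (fun h => hx (interlaced_iff.1 h).1), mul_zero]
    refine Finset.sum_eq_zero fun c hc => ?_
    rw [Finset.mem_filter] at hc
    exact absurd (mem_heightTuples_of_produces le_rfl hc.2) hx

/-! ### The parameter `v` and the constants `A_{n,m}` -/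

lemma one_sub_vParam_pos {a b : ℝ} (ha : 0 < a) (hb : 0 < b) : 0 < 1 - 2 * vParam a b := by
  have : 1 - 2 * vParam a b = 2 * a ^ 2 / (a ^ 2 + b ^ 2) := by
    unfold vParam
    field_simp
    ring
  rw [this]
  positivity

lemma one_add_vParam_pos {a b : ℝ} (ha : 0 < a) (hb : 0 < b) : 0 < 1 + 2 * vParam a b := by
  have : 1 + 2 * vParam a b = 2 * b ^ 2 / (a ^ 2 + b ^ 2) := by
    unfold vParam
    field_simp
    ring
  rw [this]
  positivity

/-- The product of the first `n` row factors. -/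
def rowProd (n : ℕ) (u : ℝ) : ℝ := ∏ s ∈ Finset.range n, rowFactor s u

lemma rowFactor_pos {u : ℝ} (h1 : 0 < 1 - 2 * u) (h2 : 0 < 1 + 2 * u) (r : ℕ) :
    0 < rowFactor r u := by
  unfold rowFactor
  split_ifs
  · exact half_pos h2
  · exact half_pos h1

lemma rowProd_pos {u : ℝ} (h1 : 0 < 1 - 2 * u) (h2 : 0 < 1 + 2 * u) (n : ℕ) :
    0 < rowProd n u :=
  Finset.prod_pos fun r _ => rowFactor_pos h1 h2 r

lemma rowProd_mul_neg (n : ℕ) (u : ℝ) :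
    rowProd n u * rowProd n (-u) = ((1 - 4 * u ^ 2) / 4) ^ n := by
  simp only [rowProd, ← Finset.prod_mul_distrib, rowFactor_mul_neg, Finset.prod_const,
    Finset.card_range]

lemma rowProd_four_mul (k : ℕ) (u : ℝ) :
    rowProd (4 * k) u = ((1 - 4 * u ^ 2) / 4) ^ (2 * k) := by
  induction k with
  | zero => simp [rowProd]
  | succ k ih =>
    have h0 : (4 * k) % 4 = 0 := by omega
    have h1 : (4 * k + 1) % 4 = 1 := by omega
    have h2 : (4 * k + 2) % 4 = 2 := by omega
    have h3 : (4 * k + 3) % 4 = 3 := by omega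
    unfold rowProd at *
    rw [show 4 * (k + 1) = 4 * k + 1 + 1 + 1 + 1 by ring, Finset.prod_range_succ,
      Finset.prod_range_succ, Finset.prod_range_succ, Finset.prod_range_succ, ih]
    simp only [rowFactor, h0, h1, h2, h3]
    norm_num
    ring

/-- The factor of `A v n m` for odd `m`. -/
def oddFactor (v : ℝ) (n : ℕ) : ℝ :=
  if n % 4 = 1 then √((1 + 2 * v) / (1 - 2 * v))
  else if n % 4 = 3 then √((1 - 2 * v) / (1 + 2 * v)) else 1

lemma sqrt_mul_sqrt_div {s t : ℝ} (hs : 0 < s) (ht : 0 < t) :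
    √(s * t / 4) * √(s / t) = s / 2 := by
  rw [← Real.sqrt_mul (by positivity), show s * t / 4 * (s / t) = (s / 2) ^ 2 by field_simp; ring,
    Real.sqrt_sq (by positivity)]

lemma rowProd_eq {v : ℝ} (h1 : 0 < 1 - 2 * v) (h2 : 0 < 1 + 2 * v) (n : ℕ) :
    rowProd n v = √((1 - 4 * v ^ 2) / 4) ^ n * oddFactor v n := by
  have hq : (1 - 4 * v ^ 2) / 4 = (1 + 2 * v) * (1 - 2 * v) / 4 := by ring
  have hq' : (1 - 4 * v ^ 2) / 4 = (1 - 2 * v) * (1 + 2 * v) / 4 := by ring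
  have hq0 : 0 ≤ (1 - 4 * v ^ 2) / 4 := by rw [hq]; positivity
  have hsq : √((1 - 4 * v ^ 2) / 4) ^ 2 = (1 - 4 * v ^ 2) / 4 := Real.sq_sqrt hq0
  have hplus : √((1 - 4 * v ^ 2) / 4) * √((1 + 2 * v) / (1 - 2 * v)) = (1 + 2 * v) / 2 := by
    rw [hq]; exact sqrt_mul_sqrt_div h2 h1
  have hminus : √((1 - 4 * v ^ 2) / 4) * √((1 - 2 * v) / (1 + 2 * v)) = (1 - 2 * v) / 2 := by
    rw [hq']; exact sqrt_mul_sqrt_div h1 h2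
  obtain ⟨k, hk⟩ : ∃ k, n = 4 * k + n % 4 := ⟨n / 4, by omega⟩
  have hlt : n % 4 < 4 := Nat.mod_lt _ (by norm_num)
  have hpow : √((1 - 4 * v ^ 2) / 4) ^ (4 * k) = ((1 - 4 * v ^ 2) / 4) ^ (2 * k) := by
    rw [show 4 * k = 2 * (2 * k) by ring, pow_mul, hsq]
  have m0 : (4 * k) % 4 = 0 := by omega
  have m1 : (4 * k + 1) % 4 = 1 := by omega
  have m2 : (4 * k + 2) % 4 = 2 := by omega
  have m3 : (4 * k + 3) % 4 = 3 := by omega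
  have hr := rowProd_four_mul k v
  have f0 : rowFactor (4 * k) v = (1 + 2 * v) / 2 := by simp [rowFactor, m0]
  have f1 : rowFactor (4 * k + 1) v = (1 - 2 * v) / 2 := by simp [rowFactor, m1]
  have f2 : rowFactor (4 * k + 2) v = (1 - 2 * v) / 2 := by simp [rowFactor, m2]
  rcases (by omega : n % 4 = 0 ∨ n % 4 = 1 ∨ n % 4 = 2 ∨ n % 4 = 3) with h | h | h | h <;>
    rw [h] at hk <;> subst hk
  · rw [add_zero, hr, hpow, oddFactor, m0]
    simp
  · have e : rowProd (4 * k + 1) v = rowProd (4 * k) v * ((1 + 2 * v) / 2) := by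
      rw [rowProd, Finset.prod_range_succ, rowProd, f0]
    rw [e, hr, pow_succ _ (4 * k), hpow, oddFactor, if_pos m1, mul_assoc, hplus]
  · have e : rowProd (4 * k + 2) v = rowProd (4 * k) v * ((1 - 4 * v ^ 2) / 4) := by
      rw [rowProd, Finset.prod_range_succ, Finset.prod_range_succ, rowProd, f0, f1]
      ring
    rw [e, hr, pow_add, hpow, hsq]
    simp [oddFactor, m2]
  · have e : rowProd (4 * k + 3) v =
        rowProd (4 * k) v * ((1 - 4 * v ^ 2) / 4) * ((1 - 2 * v) / 2) := by
      rw [rowProd, Finset.prod_range_succ, Finset.prod_range_succ, Finset.prod_range_succ, rowProd,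
        f0, f1, f2]
      ring
    rw [e, hr, pow_add _ (4 * k), hpow, pow_succ _ 2, hsq, oddFactor, if_neg (by omega), if_pos m3,
      ← hminus]
    ring

/-- The constants `A_{n,m}` in terms of row products. -/
lemma A_eq {v : ℝ} (h1 : 0 < 1 - 2 * v) (h2 : 0 < 1 + 2 * v) {n m : ℕ} :
    A v n m = √((1 - 4 * v ^ 2) / 4) ^ ((m : ℤ) * (n + 1 - m)) *
      if m % 2 = 1 then rowProd n v / √((1 - 4 * v ^ 2) / 4) ^ n else 1 := by
  have hq : 0 < (1 - 4 * v ^ 2) / 4 := by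
    rw [show (1 - 4 * v ^ 2) / 4 = (1 - 2 * v) * (1 + 2 * v) / 4 by ring]; positivity
  have hs : √((1 - 4 * v ^ 2) / 4) ≠ 0 := (Real.sqrt_pos.2 hq).ne'
  rw [A, rowProd_eq h1 h2]
  congr 1
  · rw [Real.sqrt_eq_rpow, ← Real.rpow_intCast, ← Real.rpow_mul hq.le]
    congr 1
    push_cast
    ring
  · by_cases hm : m % 2 = 1
    · rw [if_pos hm, mul_div_cancel_left₀ _ (pow_ne_zero n hs), oddFactor]
      simp [hm]
    · simp [hm]

lemma A_one {v : ℝ} (h1 : 0 < 1 - 2 * v) (h2 : 0 < 1 + 2 * v) (n : ℕ) :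
    A v n 1 = rowProd n v := by
  have hq : 0 < (1 - 4 * v ^ 2) / 4 := by
    rw [show (1 - 4 * v ^ 2) / 4 = (1 - 2 * v) * (1 + 2 * v) / 4 by ring]; positivity
  have hs : √((1 - 4 * v ^ 2) / 4) ≠ 0 := (Real.sqrt_pos.2 hq).ne'
  rw [A_eq h1 h2, if_pos (by norm_num)]
  push_cast
  rw [show (1 : ℤ) * (n + 1 - 1) = n by ring, zpow_natCast, mul_div_cancel₀ _ (pow_ne_zero n hs)]

/-- The recursion of the constants in `m`. -/
lemma A_succ {v : ℝ} (h1 : 0 < 1 - 2 * v) (h2 : 0 < 1 + 2 * v) {n m : ℕ} (hm : m ≤ n) :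
    A v n m = A v n (m + 1) *
      (rowProd n ((-1) ^ (m + 1) * v) / ((1 - 4 * v ^ 2) / 4) ^ (n - m)) := by
  have hq : 0 < (1 - 4 * v ^ 2) / 4 := by
    rw [show (1 - 4 * v ^ 2) / 4 = (1 - 2 * v) * (1 + 2 * v) / 4 by ring]; positivity
  have hs : √((1 - 4 * v ^ 2) / 4) ≠ 0 := (Real.sqrt_pos.2 hq).ne'
  have hsq : √((1 - 4 * v ^ 2) / 4) ^ 2 = (1 - 4 * v ^ 2) / 4 := Real.sq_sqrt hq.le
  have hprod := rowProd_mul_neg n v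
  have hR := (rowProd_pos h1 h2 n).ne'
  rw [A_eq h1 h2, A_eq h1 h2]
  generalize √((1 - 4 * v ^ 2) / 4) = s at *
  rw [← hsq, ← pow_mul] at hprod
  rw [← hsq, ← pow_mul]
  obtain ⟨k, rfl⟩ := Nat.exists_eq_add_of_le hm
  have e1 : (m : ℤ) * ((m + k : ℕ) + 1 - m) = ((m * (k + 1) : ℕ) : ℤ) := by push_cast; ring
  have e2 : ((m + 1 : ℕ) : ℤ) * ((m + k : ℕ) + 1 - (m + 1 : ℕ)) = (((m + 1) * k : ℕ) : ℤ) := by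
    push_cast; ring
  rw [e1, e2, zpow_natCast, zpow_natCast, Nat.add_sub_cancel_left]
  rcases Nat.even_or_odd m with hev | hodd
  · have m1 : m % 2 = 0 := Nat.even_iff.1 hev
    have m2 : (m + 1) % 2 = 1 := by omega
    rw [if_neg (by omega), if_pos m2, hev.add_one.neg_one_pow, neg_one_mul]
    field_simp
    rw [mul_assoc (s ^ ((m + 1) * k)), hprod, ← pow_add, ← pow_add, ← pow_add]
    congr 1
    ring
  · have m1 : m % 2 = 1 := Nat.odd_iff.1 hodd
    rw [if_pos m1, if_neg (by omega), hodd.add_one.neg_one_pow, one_mul]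
    field_simp
    rw [← pow_add, ← pow_add]
    congr 1
    ring

/-! ### Removing the levels one at a time -/

lemma produces_succ_iff {n m : ℕ} (c : Config n) (x : Positions) (z : Fin (m + 1) → ℤ) :
    Produces c (m + 1) (Function.update x (m + 1) z) ↔
      Produces c m x ∧ StrictMono z ∧ Set.range z = particles c (m + 1) := by
  constructor
  · intro h
    refine ⟨fun ℓ h1 h2 => ?_, ?_⟩
    · have := h ℓ h1 (by omega)
      rwa [Function.update_of_ne (by omega)] at this
    · have := h (m + 1) (by omega) le_rfl
      rwa [Function.update_self] at this
  · rintro ⟨h, hz⟩ ℓ h1 h2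
    rcases h2.eq_or_lt with rfl | h2
    · rwa [Function.update_self]
    · rw [Function.update_of_ne (by omega)]
      exact h ℓ h1 (by omega)

/-- The density of `m` levels is the marginal of the density of `m + 1` levels. -/
lemma density_eq_sum (a b : ℝ) {n m : ℕ} (hm : m ≤ n) (x : Positions) :
    density a b n m x = ∑ z ∈ heightTuples n (m + 1),
      density a b n (m + 1) (Function.update x (m + 1) z) := by
  classical
  simp only [density, Finset.sum_filter, produces_succ_iff]
  rw [Finset.sum_comm]
  refine Finset.sum_congr rfl fun c _ => ?_
  obtain ⟨z, ⟨hz, hr⟩, hu⟩ := existsUnique_particles c (k := m + 1) (by omega) (by omega)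
  rw [Finset.sum_eq_single_of_mem z hz]
  · simp [hr, (mem_heightTuples.1 hz).2]
  · intro z' hz' hne
    rw [if_neg]
    rintro ⟨-, -, hr'⟩
    exact hne (hu z' ⟨hz', hr'⟩)

open Classical in
lemma chi_update {n m : ℕ} (hm : 1 ≤ m) (x : Positions) {z : Fin (m + 1) → ℤ}
    (hz : z ∈ heightTuples n (m + 1)) :
    chi n (m + 1) (Function.update x (m + 1) z) =
      chi n m x * if Interlaces (x m) z then 1 else 0 := by
  have h : Interlaced n (m + 1) (Function.update x (m + 1) z) ↔
      Interlaced n m x ∧ Interlaces (x m) z := by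
    rw [interlaced_iff, interlaced_iff]
    constructor
    · rintro ⟨h, h'⟩
      refine ⟨⟨fun ℓ h1 h2 => ?_, fun ℓ h1 h2 => ?_⟩, ?_⟩
      · have := h ℓ h1 (by omega)
        rwa [Function.update_of_ne (by omega)] at this
      · have := h' ℓ h1 (by omega)
        rwa [Function.update_of_ne (by omega), Function.update_of_ne (by omega)] at this
      · have := h' m hm (by omega)
        rwa [Function.update_of_ne (by omega), Function.update_self] at this
    · rintro ⟨⟨h, h'⟩, hi⟩
      refine ⟨fun ℓ h1 h2 => ?_, fun ℓ h1 h2 => ?_⟩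
      · rcases h2.eq_or_lt with rfl | h2
        · rwa [Function.update_self]
        · rw [Function.update_of_ne (by omega)]
          exact h ℓ h1 (by omega)
      · rcases (Nat.lt_succ_iff.1 h2).eq_or_lt with rfl | h2
        · rwa [Function.update_of_ne (by omega), Function.update_self]
        · rw [Function.update_of_ne (by omega), Function.update_of_ne (by omega)]
          exact h' ℓ h1 h2
  simp only [chi, h, ite_and]
  split_ifs <;> simp

lemma edgeProb_add (v : ℝ) (m : ℕ) (t : ℤ) :
    edgeProb v (m + t) = edgeProb ((-1) ^ m * v) t := by
  induction m with
  | zero => simp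
  | succ m ih =>
    rw [Nat.cast_succ, add_right_comm, edgeProb_add_one, ih, pow_succ, mul_neg_one, neg_mul,
      edgeProb_neg]

lemma Omega_update {a b : ℝ} (hab : a ^ 2 + b ^ 2 ≠ 0) {m : ℕ} (hm : 1 ≤ m) (x : Positions)
    (z : Fin (m + 1) → ℤ) :
    Omega a b m (Function.update x (m + 1) z) = Omega a b (m - 1) x *
      levelWeight (edgeProb ((-1) ^ m * vParam a b)) (x m) z := by
  obtain ⟨k, rfl⟩ : ∃ k, m = k + 1 := ⟨m - 1, by omega⟩
  rw [Omega_eq_prod hab, Omega_eq_prod hab, Finset.prod_Icc_succ_top (by omega),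
    Nat.add_sub_cancel, Function.update_self, Function.update_of_ne (by omega)]
  congr 1
  · refine Finset.prod_congr rfl fun ℓ hℓ => ?_
    rw [Finset.mem_Icc] at hℓ
    rw [Function.update_of_ne (by omega), Function.update_of_ne (by omega)]
  · congr 1
    funext t
    exact edgeProb_add _ _ _

open Classical in
/-- The density of all levels is a constant multiple of `Ω χ`. -/
lemma density_all {a b : ℝ} (ha : 0 < a) (hb : 0 < b) (n : ℕ) (x : Positions) :
    density a b n (n + 1) x = weightConst a b n / partitionFunction a b n *
      (Omega a b n x * chi n (n + 1) x) := by
  have hab : a ^ 2 + b ^ 2 ≠ 0 := by positivity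
  rw [← sum_produces_eq hab n x, density, Finset.mul_sum]
  refine Finset.sum_congr (by ext; simp) fun c _ => ?_
  rw [prob, weight_eq_weightConst_mul ha hb]
  ring

lemma partitionFunction_pos {a b : ℝ} (ha : 0 < a) (hb : 0 < b) (n : ℕ) :
    0 < partitionFunction a b n := by
  classical
  have hv1 := one_sub_vParam_pos ha hb
  have hv2 := one_add_vParam_pos ha hb
  have hprob : ∀ t, 0 < edgeProb (vParam a b) t := by
    intro t
    unfold edgeProb
    split_ifs <;> linarith
  have hab : a ^ 2 + b ^ 2 ≠ 0 := by positivity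
  -- the frozen configuration, in which the particles of each level are at the lowest heights
  have h := sum_produces_eq hab n (fun ℓ i => ((i : ℕ) : ℤ))
  have hchi : chi n (n + 1) (fun ℓ i => ((i : ℕ) : ℤ)) = 1 := by
    rw [chi, if_pos]
    rw [interlaced_iff]
    refine ⟨fun ℓ _ hℓ => natCast_mem_heightTuples hℓ, fun ℓ _ _ i => ?_⟩
    simp
  have hO : 0 < Omega a b n (fun ℓ i => ((i : ℕ) : ℤ)) := by
    unfold Omega
    positivity
  rw [hchi, mul_one] at h
  have hne : (Finset.univ : Finset (Config n)).Nonempty := by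
    by_contra hc
    rw [Finset.not_nonempty_iff_eq_empty] at hc
    rw [hc, Finset.filter_empty, Finset.sum_empty] at h
    exact hO.ne h
  refine Finset.sum_pos (fun c _ => ?_) hne
  rw [weight_eq_weightConst_mul ha hb]
  refine mul_pos (weightConst_pos ha hb n) (Finset.prod_pos fun ℓ _ => Finset.prod_pos fun k _ => ?_)
  split_ifs
  · exact hprob _
  · exact one_pos

lemma density_zero {a b : ℝ} (ha : 0 < a) (hb : 0 < b) (n : ℕ) (x : Positions) :
    density a b n 0 x = 1 := by
  classical
  have : ∀ c : Config n, Produces c 0 x := fun c ℓ h1 h2 => by omega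
  simp only [density, this, Finset.filter_true, prob]
  rw [← Finset.sum_div]
  exact div_self (partitionFunction_pos ha hb n).ne'

/-- The determinant in the density of the first `m` levels. -/
def levelDet (v : ℝ) (n m : ℕ) (y : Fin m → ℤ) : ℝ :=
  Matrix.det (Matrix.of fun i j : Fin m => L (n + 1 - m + (i : ℕ)) (y j) ((-1) ^ m * v))

lemma neg_one_pow_mul_bounds {v : ℝ} (h1 : 0 < 1 - 2 * v) (h2 : 0 < 1 + 2 * v) (m : ℕ) :
    0 < 1 - 2 * ((-1) ^ m * v) ∧ 0 < 1 + 2 * ((-1) ^ m * v) := by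
  rcases neg_one_pow_eq_or ℝ m with h | h <;> rw [h] <;> constructor <;> linarith

/-- One step of the backward induction on the number of levels. -/
lemma sum_levelDet {v : ℝ} (h1 : 0 < 1 - 2 * v) (h2 : 0 < 1 + 2 * v) {n m : ℕ} (hm : 1 ≤ m)
    (hmn : m ≤ n) {y : Fin m → ℤ} (hy : y ∈ heightTuples n m) :
    A v n (m + 1) * (open Classical in
      ∑ z ∈ heightTuples n (m + 1) with Interlaces y z,
        levelWeight (edgeProb ((-1) ^ m * v)) y z * levelDet v n (m + 1) z) =
    A v n m * levelDet v n m y := by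
  obtain ⟨k, rfl⟩ : ∃ k, m = k + 1 := ⟨m - 1, by omega⟩
  have hu : -((-1 : ℝ) ^ (k + 1 + 1) * v) = (-1) ^ (k + 1) * v := by ring
  have hu2 : ((-1 : ℝ) ^ (k + 1 + 1) * v) ^ 2 = v ^ 2 := by
    rw [mul_pow, ← pow_mul, mul_comm (k + 1 + 1), pow_mul]; norm_num
  obtain ⟨b1, b2⟩ := neg_one_pow_mul_bounds h1 h2 (k + 1 + 1)
  have h := sum_levelWeight_mul_det b1.ne' b2.ne' (n := n) (N := n - (k + 1)) (m := k)
    (by omega) hy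
  rw [hu, hu2] at h
  rw [A_succ h1 h2 hmn, mul_assoc]
  congr 1
  have e1 : n + 1 - (k + 1 + 1) = n - (k + 1) := by omega
  have e2 : n + 1 - (k + 1) = n - (k + 1) + 1 := by omega
  simp only [levelDet, e1, e2]
  exact h

/-- The density up to a constant that depends neither on the number of levels nor on the
positions. -/
lemma exists_density_eq {a b : ℝ} (ha : 0 < a) (hb : 0 < b) (n : ℕ) :
    ∃ K : ℝ, ∀ m, 1 ≤ m → m ≤ n + 1 → ∀ x : Positions, density a b n m x =
      K * (A (vParam a b) n m * levelDet (vParam a b) n m (x m) * Omega a b (m - 1) x *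
        chi n m x) := by
  classical
  have h1 := one_sub_vParam_pos ha hb
  have h2 := one_add_vParam_pos ha hb
  have hab : a ^ 2 + b ^ 2 ≠ 0 := by positivity
  set v := vParam a b with hv
  -- the only possible determinant at the level `n + 1`, which is completely filled
  set D := A v n (n + 1) * levelDet v n (n + 1) (fun i => ((i : ℕ) : ℤ)) with hD
  have hA : A v n (n + 1) ≠ 0 := by
    have hq : 0 < (1 - 4 * v ^ 2) / 4 := by
      rw [show (1 - 4 * v ^ 2) / 4 = (1 - 2 * v) * (1 + 2 * v) / 4 by ring]; positivity
    have hs := Real.sqrt_pos.2 hq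
    rw [A_eq h1 h2]
    refine mul_ne_zero (zpow_ne_zero _ hs.ne') ?_
    split_ifs
    · exact div_ne_zero (rowProd_pos h1 h2 n).ne' (pow_ne_zero n hs.ne')
    · exact one_ne_zero
  have hD0 : D ≠ 0 := by
    refine mul_ne_zero hA ?_
    obtain ⟨b1, b2⟩ := neg_one_pow_mul_bounds h1 h2 (n + 1)
    rw [levelDet, Matrix.det_of_isLowerTriangular]
    · refine Finset.prod_ne_zero_iff.2 fun i _ => ?_
      rw [Matrix.of_apply, Nat.sub_self, zero_add]
      exact L_diag_ne_zero b1.ne' b2.ne' i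
    · intro i j hij
      rw [Matrix.of_apply, Nat.sub_self, zero_add]
      exact L_eq_zero_of_lt _ (by simpa using hij) _
  refine ⟨weightConst a b n / partitionFunction a b n / D, fun m hm1 hmn => ?_⟩
  induction hmn using Nat.decreasingInduction with
  | self =>
    intro x
    rw [density_all ha hb, Nat.add_sub_cancel]
    by_cases hx : Interlaced n (n + 1) x
    · have hfull := eq_natCast_of_mem_heightTuples
        ((interlaced_iff.1 hx).1 (n + 1) (by omega) le_rfl)
      rw [hfull, ← hD]
      field_simp
    · rw [chi, if_neg hx]
      ring
  | of_succ m hmn ih =>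
    intro x
    have ih := ih (by omega)
    rw [density_eq_sum a b (Nat.lt_succ_iff.1 hmn)]
    simp only [ih, Function.update_self, Nat.add_sub_cancel, Omega_update hab hm1]
    rw [Finset.sum_congr rfl fun z hz => by rw [chi_update hm1 x hz]]
    by_cases hx : Interlaced n m x
    · have hy := (interlaced_iff.1 hx).1 m hm1 le_rfl
      rw [← sum_levelDet h1 h2 hm1 (Nat.lt_succ_iff.1 hmn) hy, Finset.mul_sum, Finset.sum_mul,
        Finset.sum_mul, Finset.mul_sum, Finset.sum_filter]
      refine Finset.sum_congr rfl fun z _ => ?_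
      split_ifs <;> ring
    · rw [chi, if_neg hx]
      simp

lemma sum_heightTuples_one (n : ℕ) (f : ℤ → ℝ) :
    ∑ z ∈ heightTuples n 1, f (z 0) = ∑ t ∈ Finset.Icc (0 : ℤ) n, f t := by
  refine Finset.sum_bij (fun z _ => z 0) ?_ ?_ ?_ ?_
  · intro z hz
    exact Finset.mem_Icc.2 ((mem_heightTuples.1 hz).1 0)
  · intro z _ z' _ h
    funext i
    rw [Subsingleton.elim i 0]
    exact h
  · intro t ht
    exact ⟨fun _ => t, mem_heightTuples.2
      ⟨fun _ => Finset.mem_Icc.1 ht, Subsingleton.strictMono _⟩, rfl⟩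
  · intro z _
    rfl

/-- The formula for the first level sums to `1`, which determines the constant. -/
lemma sum_first_level {v : ℝ} (h1 : 0 < 1 - 2 * v) (h2 : 0 < 1 + 2 * v) (n : ℕ) :
    ∑ z ∈ heightTuples n 1, A v n 1 * levelDet v n 1 z = 1 := by
  obtain ⟨b1, b2⟩ := neg_one_pow_mul_bounds h1 h2 1
  have hdet : ∀ z : Fin 1 → ℤ, levelDet v n 1 z = L n (z 0) (-v) := by
    intro z
    simp [levelDet]
  have hsum : ∑ t ∈ Finset.Icc (0 : ℤ) n, L n t (-v) = cumL n (-v) (n + 1) := by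
    have h : Finset.Icc (0 : ℤ) n = Finset.Ico 0 ((n : ℤ) + 1) := by
      ext; simp only [Finset.mem_Icc, Finset.mem_Ico]; omega
    rw [cumL, L_eq_zero_of_lt n (by omega), mul_zero, add_zero, h]
  rw [pow_one, neg_one_mul] at b1 b2
  simp only [hdet]
  rw [← Finset.mul_sum, sum_heightTuples_one n (fun t => L n t (-v)), hsum,
    cumL_of_lt b1.ne' b2.ne' (by omega), neg_neg, Finset.prod_inv_distrib, A_one h1 h2]
  exact mul_inv_cancel₀ (rowProd_pos h1 h2 n).ne'

end TwoPeriodicAztec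

end

theorem mainTheorem3 (a b : ℝ) (ha : 0 < a) (hb : 0 < b) (n m : ℕ) (hm : 1 ≤ m)
    (hmn : m ≤ n + 1) (x : TwoPeriodicAztec.Positions) :
    TwoPeriodicAztec.density a b n m x =
      TwoPeriodicAztec.A (TwoPeriodicAztec.vParam a b) n m *
        Matrix.det (Matrix.of fun i j : Fin m =>
          -- the row index is `n - m + i` with `i = 1, …, m`
          TwoPeriodicAztec.L (n + 1 - m + (i : ℕ)) (x m j)
            ((-1) ^ m * TwoPeriodicAztec.vParam a b)) *
        TwoPeriodicAztec.Omega a b (m - 1) x *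
        TwoPeriodicAztec.chi n m x := by
  open TwoPeriodicAztec in
  classical
  obtain ⟨K, hK⟩ := exists_density_eq ha hb n
  have hone : ∀ z ∈ heightTuples n 1, density a b n 1 (Function.update x 1 z) =
      K * (A (vParam a b) n 1 * levelDet (vParam a b) n 1 z) := by
    intro z hz
    have hchi : chi n 1 (Function.update x 1 z) = 1 := by
      rw [chi, if_pos]
      rw [interlaced_iff]
      refine ⟨fun ℓ h1 h2 => ?_, fun ℓ h1 h2 => by omega⟩
      obtain rfl : ℓ = 1 := by omega
      rwa [Function.update_self]
    rw [hK 1 le_rfl (by omega), Function.update_self, hchi]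
    simp [Omega, total]
  have hK1 : K = 1 := by
    have h := density_eq_sum a b (Nat.zero_le n) x
    rw [density_zero ha hb, zero_add, Finset.sum_congr rfl hone, ← Finset.mul_sum,
      sum_first_level (one_sub_vParam_pos ha hb) (one_add_vParam_pos ha hb), mul_one] at h
    exact h.symm
  rw [hK m hm hmn x, hK1, one_mul, levelDet]
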